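/- Let $p$ be a prime, $q=p^e$ with $e\ge 1$, and let $f(T)\in\mathbb Z[T]$ be a $q$-Weil polynomial of degree $4$, i.e. a monic polynomial whose complex roots can be ordered as $\alpha_1,\dots,\alpha_4$ with $\alpha_1\alpha_3=\alpha_2\alpha_4=q$ and $|\alpha_j|=\sqrt q$ for all $j$. Assume that * (ordinary) the coefficient of $T^2$ in $f$ is prime to $p$; * (Galois) $f$ is irreducible over $\mathbb Q$, and $K=\mathbb Q[T]/(f(T))$ is Galois over $\mathbb Q$ and unramified at $p$; * (maximal) if $\varpi$ denotes a root of $f$, with complex conjugate $\bar\varpi$, then $\mathbb Z[\varpi,\bar\varpi]$ is the full ring of integers $\mathcal O_K$. Then $K$ is a CM field with an intrinsic complex conjugation $a\mapsto\bar a$; let $K^+$ be its maximal totally real subfield. Let $\ell\ne p$ be a prime and $\kappa(\ell)=\mathcal O_K\otimes\mathbb F_\ell$, a four-dimensional $\mathbb F_\ell$-vector space. There is a symplectic (alternating, nondegenerate) pairing $\langle\cdot,\cdot\rangle$ on $\kappa(\ell)$ with $\langle ax,y\rangle=\langle x,\bar a y\rangle$ for all $a\in\mathcal O_K$. Choose any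 such pairing and any symplectic basis; multiplication by $\varpi$ on $\kappa(\ell)$ then becomes an element $\gamma_\ell\in \mathrm{GSp}_4(\mathbb F_\ell)$ of multiplier $q$. Call $\gamma\in\mathrm{GSp}_4(\mathbb F_\ell)$ cyclic if $\{\gamma^i v: i\ge 0\}$ spans $\mathbb F_\ell^4$ for some $v$, write $\gamma_{ss}$ for the semisimple part of $\gamma$ in its Jordan decomposition, and let $\mathrm{GSp}_4(\mathbb F_\ell)^{(q)}$ be the set of elements of multiplier $q$. Put $$\nu_\ell(f)=\frac{\#\{\gamma\in \mathrm{GSp}_4(\mathbb F_\ell):\ \gamma \text{ is cyclic and } \gamma_{ss} \text{ is } \mathrm{GSp}_4(\mathbb F_\ell)\text{-conjugate to } (\gamma_\ell)_{ss}\}}{\#\mathrm{GSp}_4(\mathbb F_\ell)^{(q)}/\ell^2}.$$ For a character $\chi:\mathrm{Gal}(K/\mathbb Q)\to\mathbb C^\times$ let $K^\chi$ be the fixed field of $\ker\chi$; let $\chi(\ell)=\chi(\mathrm{Frob}_{K^\chi}(\ell))$ if $\ell$ is unramified in $K^\chi$, and $\chi(\ell)=0$ otherwise. Let $S(K)$ be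 the set of characters of $\mathrm{Gal}(K/\mathbb Q)$ that do not factor through $\mathrm{Gal}(K^+/\mathbb Q)$, and put $$\nu_\ell(K)=\prod_{\chi\in S(K)}\frac{1}{1-\chi(\ell)/\ell}.$$ Then, for every prime $\ell\neq p$ and every choice of the pairing and the symplectic basis, $\nu_\ell(f)=\nu_\ell(K)$. -/

import Mathlib

open Polynomial NumberField TensorProduct

noncomputable section

namespace WeilSurface

/-! ### Quartic Weil polynomials -/

/-- `f` is a `q`-Weil polynomial of degree `4`: it is a monic integral quartic whose complex roots
`α₀, α₁, β₀, β₁` satisfy `αⱼ * βⱼ = q` and all have absolute value `√q`. -/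
def IsWeilQuartic (q : ℕ) (f : ℤ[X]) : Prop :=
  f.Monic ∧ f.natDegree = 4 ∧
    ∃ α β : Fin 2 → ℂ,
      f.map (Int.castRingHom ℂ) = ∏ j, (X - C (α j)) * (X - C (β j)) ∧
      (∀ j, α j * β j = q) ∧ ∀ j, ‖α j‖ = √(q : ℝ) ∧ ‖β j‖ = √(q : ℝ)

/-- The rational prime `ℓ` is unramified in the number field `L`. -/
def IsUnramifiedIn (L : Type*) [Field L] [NumberField L] (ℓ : ℕ) : Prop :=
  ∀ (P : Ideal (𝓞 L)) [P.IsPrime], P.LiesOver (Ideal.span {(ℓ : ℤ)}) → Algebra.IsUnramifiedAt ℤ P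

/-- `(K, ϖ)` is the field `ℚ[T]/(f)` together with the class of `T`. -/
def IsRootField (f : ℤ[X]) (K : Type*) [Field K] [NumberField K] (ϖ : K) : Prop :=
  aeval ϖ f = 0 ∧ IntermediateField.adjoin ℚ {ϖ} = ⊤

/-- The order `ℤ[ϖ, ϖ̄]` is the maximal order of `K`, where `ϖ` is viewed as a complex number
through any complex embedding `φ` of `K`, and the maximal order as a subring of `ℂ`. -/
def IsMaximalWeil (K : Type*) [Field K] [NumberField K] (ϖ : K) : Prop :=
  ∀ φ : K →+* ℂ, Algebra.adjoin ℤ {φ ϖ, starRingEnd ℂ (φ ϖ)} =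
    (integralClosure ℤ K).map φ.toIntAlgHom

/-- The hypotheses on `f`: it is a `q`-Weil polynomial of degree `4`, where `q` is a power of `p`,
which is ordinary, irreducible, with `K = ℚ[T]/(f)` unramified at `p`, and maximal. (That `K` is
Galois over `ℚ` is a separate hypothesis.) -/
structure IsAdmissible (p q : ℕ) (f : ℤ[X]) (K : Type*) [Field K] [NumberField K] (ϖ : K) :
    Prop where
  primePow : ∃ e : ℕ, e ≠ 0 ∧ q = p ^ e
  weil : IsWeilQuartic q f
  ordinary : IsCoprime (f.coeff 2) (p : ℤ)
  irreducible : Irreducible (f.map (Int.castRingHom ℚ))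
  rootField : IsRootField f K ϖ
  unramified : IsUnramifiedIn K p
  maximal : IsMaximalWeil K ϖ

/-! ### The symplectic similitude group `GSp₄` -/

/-- The standard symplectic form on `k⁴`. -/
def J (k : Type*) [Field k] : Matrix (Fin 2 ⊕ Fin 2) (Fin 2 ⊕ Fin 2) k :=
  Matrix.fromBlocks 0 1 (-1) 0

/-- `GSp₄(k)⁽ᵐ⁾`: the symplectic similitudes of multiplier `m`. -/
def GSpMult (k : Type*) [Field k] (m : k) : Set (GL (Fin 2 ⊕ Fin 2) k) :=
  {γ | γ.1.transpose * J k * γ.1 = m • J k}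

/-- `GSp₄(k)`: automorphisms of `k⁴` which preserve the standard symplectic form up to a
multiplier in `kˣ`. -/
def GSp (k : Type*) [Field k] : Set (GL (Fin 2 ⊕ Fin 2) k) :=
  {γ | ∃ m : kˣ, γ ∈ GSpMult k (m : k)}

/-- `γ` is cyclic: some vector `v` has the property that the `γ ^ i v`, `i ≥ 0`, span `k⁴`. -/
def IsCyclicElt {k : Type*} [Field k] (γ : GL (Fin 2 ⊕ Fin 2) k) : Prop :=
  ∃ v : Fin 2 ⊕ Fin 2 → k,
    Submodule.span k (Set.range fun i : ℕ => (γ.1 ^ i).mulVec v) = ⊤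

/-- `s` is the semisimplification (semisimple Jordan component) of `γ`: it is semisimple, commutes
with `γ`, and `γ - s` is nilpotent. -/
def IsSemisimplification {k : Type*} [Field k] (γ s : GL (Fin 2 ⊕ Fin 2) k) : Prop :=
  Module.End.IsSemisimple (Matrix.toLin' s.1) ∧ Commute s γ ∧ IsNilpotent (γ.1 - s.1)

/-- The semisimplifications of `γ` and `δ` are conjugate under `GSp₄(k)`. -/
def SameSemisimplification {k : Type*} [Field k] (γ δ : GL (Fin 2 ⊕ Fin 2) k) : Prop :=
  ∃ s t : GL (Fin 2 ⊕ Fin 2) k, IsSemisimplification γ s ∧ IsSemisimplification δ t ∧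
    ∃ h ∈ GSp k, h * s * h⁻¹ = t

/-! ### The element `γ_ℓ` -/

section Frobenius

variable (K : Type*) [Field K] [NumberField K] (ℓ : ℕ) [Fact ℓ.Prime]

/-- `κ(ℓ) = 𝓞_K ⊗ 𝔽_ℓ`. -/
abbrev Kappa : Type _ := ZMod ℓ ⊗[ℤ] 𝓞 K

/-- `B` is a symplectic (alternating and nondegenerate) pairing on `κ(ℓ)` with respect to which
the adjoint of (multiplication by) `a` is the complex conjugate of `a`. -/
def IsConjSymplectic (B : LinearMap.BilinForm (ZMod ℓ) (Kappa K ℓ)) : Prop :=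
  B.IsAlt ∧ B.Nondegenerate ∧
    ∃ ι : K ≃ₐ[ℚ] K, (∀ φ : K →+* ℂ, ComplexEmbedding.IsConj φ ι) ∧
      ∀ (a : 𝓞 K) (x y : Kappa K ℓ),
        B ((1 ⊗ₜ[ℤ] a) * x) y = B x ((1 ⊗ₜ[ℤ] (ι • a)) * y)

variable {K ℓ}

/-- `b` is a symplectic basis of `κ(ℓ)` for `B`; it identifies `GSp(κ(ℓ), B)` with
`GSp₄(𝔽_ℓ)`. -/
def IsSymplecticBasis (B : LinearMap.BilinForm (ZMod ℓ) (Kappa K ℓ))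
    (b : Module.Basis (Fin 2 ⊕ Fin 2) (ZMod ℓ) (Kappa K ℓ)) : Prop :=
  ∀ i j, B (b i) (b j) = J (ZMod ℓ) i j

/-- `γ` is the matrix, in the basis `b`, of the action of `ϖ` on `κ(ℓ)`. -/
def IsFrobMatrix (ϖ : K) (b : Module.Basis (Fin 2 ⊕ Fin 2) (ZMod ℓ) (Kappa K ℓ))
    (γ : GL (Fin 2 ⊕ Fin 2) (ZMod ℓ)) : Prop :=
  ∃ w : 𝓞 K, (w : K) = ϖ ∧
    γ.1 = LinearMap.toMatrix b b (LinearMap.mulLeft (ZMod ℓ) ((1 : ZMod ℓ) ⊗ₜ[ℤ] w))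

end Frobenius

/-- `ν_ℓ(f)`, where `γ_ℓ ∈ GSp₄(𝔽_ℓ)` is the matrix of the action of a root of `f` on `κ(ℓ)`. -/
def nuF (ℓ : ℕ) [Fact ℓ.Prime] (q : ℕ) (γℓ : GL (Fin 2 ⊕ Fin 2) (ZMod ℓ)) : ℚ :=
  (Set.ncard {γ : GL (Fin 2 ⊕ Fin 2) (ZMod ℓ) |
      γ ∈ GSp (ZMod ℓ) ∧ IsCyclicElt γ ∧ SameSemisimplification γ γℓ} : ℚ) /
    ((Set.ncard (GSpMult (ZMod ℓ) (q : ZMod ℓ)) : ℚ) / (ℓ : ℚ) ^ 2)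

/-! ### The local factor of `K` -/

section Field

variable {K : Type*} [Field K] [NumberField K]

/-- The field `K^χ` cut out by the character `χ`. -/
abbrev charField (χ : (K ≃ₐ[ℚ] K) →* ℂˣ) : IntermediateField ℚ K :=
  IntermediateField.fixedField χ.ker

/-- The restriction of `σ` to `E` is a Frobenius element of `Gal(E/ℚ)` over `ℓ`. -/
def RestrictsToFrob (E : IntermediateField ℚ K) (ℓ : ℕ) (σ : K ≃ₐ[ℚ] K) : Prop :=
  ∃ τ : E ≃ₐ[ℚ] E, (∀ x : E, (τ x : K) = σ x) ∧
    ∃ Q : Ideal (𝓞 E), Q.IsPrime ∧ Q.LiesOver (Ideal.span {(ℓ : ℤ)}) ∧ IsArithFrobAt ℤ τ Q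

theorem exists_restrictsToFrob [IsGalois ℚ K] (χ : (K ≃ₐ[ℚ] K) →* ℂˣ) (ℓ : ℕ)
    [hℓ : Fact ℓ.Prime] : ∃ σ, RestrictsToFrob (charField χ) ℓ σ := by
  have : IsGalois ℚ (charField χ) := IsGalois.of_fixedField_normal_subgroup χ.ker
  have hpr : (Ideal.span {(ℓ : ℤ)}).IsPrime := by
    rw [Ideal.span_singleton_prime (by exact_mod_cast hℓ.out.ne_zero)]
    exact Nat.prime_iff_prime_int.mp hℓ.out
  have hmax : (Ideal.span {(ℓ : ℤ)}).IsMaximal :=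
    hpr.isMaximal (by simpa using hℓ.out.ne_zero)
  obtain ⟨Q, hQ, hlies⟩ :=
    Ideal.exists_maximal_ideal_liesOver_of_isIntegral (S := 𝓞 (charField χ))
      (Ideal.span {(ℓ : ℤ)})
  have hbot : Q ≠ ⊥ :=
    Ideal.ne_bot_of_liesOver_of_ne_bot (p := Ideal.span {(ℓ : ℤ)})
      (by simpa using hℓ.out.ne_zero) Q
  have : Finite (𝓞 (charField χ) ⧸ Q) := Ideal.finiteQuotientOfFreeOfNeBot Q hbot
  obtain ⟨τ, hτ⟩ := IsArithFrobAt.exists_of_isInvariant ℤ (charField χ ≃ₐ[ℚ] charField χ) Q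
  obtain ⟨σ, hσ⟩ := AlgEquiv.restrictNormalHom_surjective (K₁ := charField χ) K τ
  refine ⟨σ, τ, fun x => ?_, Q, hQ.isPrime, hlies, hτ⟩
  rw [← hσ]
  exact AlgEquiv.restrictNormal_commutes σ (charField χ) x

open Classical in
/-- `χ(ℓ)`: the value of `χ` on the Frobenius at `ℓ` of `K^χ` if `ℓ` is unramified in `K^χ`, and
`0` otherwise. -/
def charValue [IsGalois ℚ K] (χ : (K ≃ₐ[ℚ] K) →* ℂˣ) (ℓ : ℕ) [Fact ℓ.Prime] : ℂ :=
  if IsUnramifiedIn (charField χ) ℓ then (χ (exists_restrictsToFrob χ ℓ).choose : ℂ) else 0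

variable (K) in
/-- `S(K)`: the characters of `Gal(K/ℚ)` which do not factor through `Gal(K⁺/ℚ)`, i.e. are
nontrivial on `Gal(K/K⁺)`, where `K⁺` is the maximal totally real subfield. -/
def imagChars : Set ((K ≃ₐ[ℚ] K) →* ℂˣ) :=
  {χ | ¬ ∀ σ : K ≃ₐ[ℚ] K, (∀ x ∈ maximalRealSubfield K, σ x = x) → χ σ = 1}

variable (K) in
/-- `ν_ℓ(K)`. -/
def nuK [IsGalois ℚ K] (ℓ : ℕ) [Fact ℓ.Prime] : ℂ :=
  ∏ᶠ χ ∈ imagChars K, (1 - charValue χ ℓ / (ℓ : ℂ))⁻¹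

end Field

end WeilSurface

end

/-! Both local factors equal `ℓ² · #Rˣ / #Aˣ`, where `A = 𝓞_K / ℓ` and `R` is the image in `A` of
`𝓞_{K⁺}`.

Matrix side. By maximality `A` is generated by `T = ϖ` and `s = ϖ + ϖ̄`, with `T² - sT + q = 0`, so
`A = R ⊕ RT` over `R = 𝔽_ℓ[s]`, whether or not `ℓ` ramifies. An alternating form on `A` for which
`T` is a similitude of multiplier `q` is `μ(det(a, b))` for a functional `μ` on `R`
(`exists_eq_form`); it is nondegenerate exactly when `μ` generates the dual of `R`, and two
generators differ by a unit of `R`. The elements counted by `ν_ℓ(f)` are the similitudes of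
multiplier `q` that make `𝔽_ℓ⁴` a free `A`-module of rank one with `T` acting as `γ`
(`setOf_sameSemisimplification_eq`). Count the isomorphisms `A ≃ 𝔽_ℓ⁴` that turn `T` into such a
similitude. Over each `γ` they form an `Aˣ`-torsor; over each generator `μ` they form an
`Sp₄`-torsor, and `Sp₄` has as many elements as `GSp₄⁽q⁾`. Hence `#{γ} · #Aˣ = #GSp₄⁽q⁾ · #Rˣ`
(`ncard_sameSemisimplification_mul`).

The delicate point is that the semisimple parts must be conjugate under `GSp₄`, not merely under
`GL₄`. This needs the centralizer of the semisimple part of `T` in `GL_R(A)` to have every unit of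
`R` as a determinant (`exists_equiv_detForm_eq`). An idempotent of `R` separates the part where the
discriminant `s² - 4q` is invertible, on which every unit is a norm from `A`, from the part where it
is nilpotent, on which the semisimple part of `T` is a scalar in `R` and `diag(1, u)` serves.

Field side. `Gal(K/ℚ)` has order four, hence is abelian. For `E = K` and `E = K⁺` the product of `1
- χ(ℓ)/ℓ` over the characters of `Gal(E/ℚ)` is `(1 - ℓ^{-f})^g = #(𝓞_E/ℓ)ˣ / ℓ^{[E:ℚ]}`
(`prod_one_sub_charValue`). The quotient of the two products is `ν_ℓ(K)`. -/

noncomputable section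

namespace WeilSurface

/-! ### Semisimplification over a prime field -/

/-- In a finite group of automorphisms over `𝔽_ℓ`, raising to a suitable power of `ℓ` is an
idempotent operation killing the `ℓ`-part. -/
theorem exists_pow_card_exponent (G : Type*) [Group G] [Finite G] (ℓ : ℕ) [hℓ : Fact ℓ.Prime] :
    ∃ M m : ℕ, 0 < M ∧ ¬ ℓ ∣ m ∧ ∀ g : G, (g ^ ℓ ^ M) ^ m = 1 ∧ (g ^ ℓ ^ M) ^ ℓ ^ M = g ^ ℓ ^ M := by
  obtain ⟨a, m, hm, hG⟩ := Nat.exists_eq_pow_mul_and_not_dvd (n := Nat.card G)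
    Nat.card_pos.ne' ℓ hℓ.out.ne_one
  have hm0 : m ≠ 0 := by rintro rfl; exact hm (dvd_zero _)
  have hφ : 0 < m.totient := Nat.totient_pos.2 (Nat.pos_of_ne_zero hm0)
  have key : ∀ g : G, (g ^ ℓ ^ ((a + 1) * m.totient)) ^ m = 1 := fun g => by
    obtain ⟨b, hb⟩ := Nat.exists_eq_add_of_le
      (show a ≤ (a + 1) * m.totient from a.le_succ.trans (Nat.le_mul_of_pos_right _ hφ))
    rw [hb, ← pow_mul, show ℓ ^ (a + b) * m = Nat.card G * ℓ ^ b by rw [hG]; ring, pow_mul,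
      pow_card_eq_one', one_pow]
  -- The exponent is at least `a`, so the `ℓ`-part dies, and a multiple of `φ(m)`, so `ℓ ^ M ≡ 1`
  -- modulo `m`; using `a + 1` keeps it positive when `a = 0`.
  refine ⟨(a + 1) * m.totient, m, Nat.mul_pos a.succ_pos hφ, hm, fun g => ⟨key g, ?_⟩⟩
  have hmod : ℓ ^ ((a + 1) * m.totient) ≡ 1 [MOD m] := by
    have := (Nat.ModEq.pow_totient ((Nat.Prime.coprime_iff_not_dvd hℓ.out).2 hm)).pow (a + 1)
    rwa [one_pow, ← pow_mul, mul_comm] at this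
  have := pow_eq_pow_of_modEq hmod (key g)
  rwa [pow_one] at this

/-- The power `γ ^ ℓ ^ M` is killed by the separable polynomial `X ^ m - 1`, and `γ - γ ^ ℓ ^ M` has
vanishing `ℓ ^ M`-th power by Frobenius. For uniqueness, the difference of two commuting candidates
is both semisimple and nilpotent. As `M` serves all `γ` at once, the Jordan decomposition becomes a
fixed power map. -/
theorem exists_isSemisimplification_iff (ℓ : ℕ) [hℓ : Fact ℓ.Prime] :
    ∃ M : ℕ, 0 < M ∧ (∀ γ : GL (Fin 2 ⊕ Fin 2) (ZMod ℓ), (γ ^ ℓ ^ M) ^ ℓ ^ M = γ ^ ℓ ^ M) ∧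
      ∀ γ s : GL (Fin 2 ⊕ Fin 2) (ZMod ℓ), IsSemisimplification γ s ↔ s = γ ^ ℓ ^ M := by
  obtain ⟨M, m, hM, hm, H⟩ := exists_pow_card_exponent (GL (Fin 2 ⊕ Fin 2) (ZMod ℓ)) ℓ
  have key : ∀ γ : GL (Fin 2 ⊕ Fin 2) (ZMod ℓ), IsSemisimplification γ (γ ^ ℓ ^ M) := fun γ => by
    refine ⟨?_, (Commute.refl γ).pow_left _, ℓ ^ M, ?_⟩
    · refine Module.End.isSemisimple_of_squarefree_aeval_eq_zero (p := X ^ m - 1) ?_ ?_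
      · refine ((X_pow_sub_one_separable_iff (F := ZMod ℓ)).2 ?_).squarefree
        rwa [Ne, ZMod.natCast_eq_zero_iff]
      · have h1 : (γ ^ ℓ ^ M).1 ^ m = 1 := by
          have := congrArg Units.val (H γ).1
          simpa using this
        rw [map_sub, map_pow, aeval_X, map_one, ← Matrix.toLin'_pow, h1, Matrix.toLin'_one,
          sub_eq_zero]
        rfl
    · have hc : Commute γ.1 (γ ^ ℓ ^ M).1 := by
        rw [Units.val_pow_eq_pow_val]; exact (Commute.refl _).pow_right _
      rw [sub_pow_char_pow_of_commute ℓ M hc, ← Units.val_pow_eq_pow_val, ← Units.val_pow_eq_pow_val,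
        (H γ).2, sub_self]
  refine ⟨M, hM, fun γ => (H γ).2, fun γ s => ⟨fun h => ?_, fun h => h ▸ key γ⟩⟩
  obtain ⟨hs, hcomm, hn⟩ := h
  obtain ⟨hs', hcomm', hn'⟩ := key γ
  have hc : Commute s (γ ^ ℓ ^ M) := hcomm.pow_right _
  have hcv : Commute s.1 (γ ^ ℓ ^ M).1 := congrArg Units.val hc
  have hc1 : Commute s.1 γ.1 := congrArg Units.val hcomm
  have hc2 : Commute (γ ^ ℓ ^ M).1 γ.1 := congrArg Units.val hcomm'
  have hnil : IsNilpotent (s.1 - (γ ^ ℓ ^ M).1) := by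
    have : s.1 - (γ ^ ℓ ^ M).1 = (γ.1 - (γ ^ ℓ ^ M).1) - (γ.1 - s.1) := by abel
    rw [this]
    refine Commute.isNilpotent_sub ?_ hn' hn
    exact ((Commute.refl _).sub_right hc1.symm).sub_left (hc2.sub_right hcv.symm)
  have hss : Module.End.IsSemisimple (Matrix.toLin' s.1 - Matrix.toLin' (γ ^ ℓ ^ M).1) := by
    refine hs.sub_of_commute ?_ hs'
    rw [Commute, SemiconjBy, Module.End.mul_eq_comp, Module.End.mul_eq_comp, ← Matrix.toLin'_mul,
      ← Matrix.toLin'_mul, hcv.eq]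
  rw [← map_sub] at hss
  have hnil' : IsNilpotent (Matrix.toLin' (s.1 - (γ ^ ℓ ^ M).1)) := by
    obtain ⟨n, hn⟩ := hnil
    exact ⟨n, by rw [← Matrix.toLin'_pow, hn, map_zero]⟩
  have := Module.End.eq_zero_of_isNilpotent_isSemisimple hnil' hss
  exact Units.ext (sub_eq_zero.1 ((LinearEquiv.map_eq_zero_iff _).1 this))

/-! ### Quadratic towers and their alternating forms -/

/-- A tower `A / R / k` of quadratic algebras, where `R = k[s]` and `A = R[T]` with
`T² - s T + q = 0`. -/
structure QuadTower (k R A : Type*) [Field k] [CommRing R] [CommRing A] [Algebra k R]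
    [Algebra k A] [Algebra R A] [IsScalarTower k R A] where
  /-- the generator of `R` over `k` -/
  s : R
  /-- the generator of `A` over `R` -/
  T : A
  /-- the norm of `T` -/
  q : k
  q_ne_zero : q ≠ 0
  /-- the basis `1, s` -/
  basisR : Module.Basis (Fin 2) k R
  /-- the basis `1, T` -/
  basisA : Module.Basis (Fin 2) R A
  basisR_zero : basisR 0 = 1
  basisR_one : basisR 1 = s
  basisA_zero : basisA 0 = 1
  basisA_one : basisA 1 = T
  T_mul_T : T * T = algebraMap R A s * T - algebraMap k A q

namespace QuadTower

variable {k R A : Type*} [Field k] [CommRing R] [CommRing A] [Algebra k R]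
    [Algebra k A] [Algebra R A] [IsScalarTower k R A] (Q : QuadTower k R A)

/-- The conjugate of `T`. -/
def Tbar : A := algebraMap R A Q.s - Q.T

theorem T_mul_Tbar : Q.T * Q.Tbar = algebraMap k A Q.q := by
  rw [Tbar, mul_sub, Q.T_mul_T]; ring

theorem isUnit_T : IsUnit Q.T := by
  refine IsUnit.of_mul_eq_one (Q.Tbar * algebraMap k A Q.q⁻¹) ?_
  rw [← mul_assoc, Q.T_mul_Tbar, ← map_mul, mul_inv_cancel₀ Q.q_ne_zero, map_one]

theorem eq_add_smul_T (a : A) :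
    a = Q.basisA.repr a 0 • (1 : A) + Q.basisA.repr a 1 • Q.T := by
  conv_lhs => rw [← Q.basisA.sum_repr a]
  rw [Fin.sum_univ_two, Q.basisA_zero, Q.basisA_one]

theorem eq_add_smul_s (r : R) :
    r = Q.basisR.repr r 0 • (1 : R) + Q.basisR.repr r 1 • Q.s := by
  conv_lhs => rw [← Q.basisR.sum_repr r]
  rw [Fin.sum_univ_two, Q.basisR_zero, Q.basisR_one]

@[simp] theorem repr_one_zero : Q.basisA.repr 1 0 = 1 := by
  rw [← Q.basisA_zero]; simp

@[simp] theorem repr_one_one : Q.basisA.repr 1 1 = 0 := by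
  rw [← Q.basisA_zero]; simp

@[simp] theorem repr_T_zero : Q.basisA.repr Q.T 0 = 0 := by
  rw [← Q.basisA_one]; simp

@[simp] theorem repr_T_one : Q.basisA.repr Q.T 1 = 1 := by
  rw [← Q.basisA_one]; simp

theorem repr_T_mul (a : A) :
    Q.basisA.repr (Q.T * a) 0 = -algebraMap k R Q.q * Q.basisA.repr a 1 ∧
      Q.basisA.repr (Q.T * a) 1 = Q.basisA.repr a 0 + Q.s * Q.basisA.repr a 1 := by
  have h : Q.T * a = (-algebraMap k R Q.q * Q.basisA.repr a 1) • (1 : A) +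
      (Q.basisA.repr a 0 + Q.s * Q.basisA.repr a 1) • Q.T := by
    conv_lhs => rw [Q.eq_add_smul_T a]
    simp only [Algebra.smul_def, map_mul, map_neg, map_add, ← IsScalarTower.algebraMap_apply]
    linear_combination algebraMap R A (Q.basisA.repr a 1) * Q.T_mul_T
  rw [h]
  simp

/-- The determinant form on `A = R ⊕ R T`. -/
def detForm (a b : A) : R :=
  Q.basisA.repr a 0 * Q.basisA.repr b 1 - Q.basisA.repr b 0 * Q.basisA.repr a 1

theorem detForm_T_mul (a b : A) :
    Q.detForm (Q.T * a) (Q.T * b) = algebraMap k R Q.q * Q.detForm a b := by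
  simp only [detForm, (Q.repr_T_mul a).1, (Q.repr_T_mul b).1, (Q.repr_T_mul a).2,
    (Q.repr_T_mul b).2]
  ring

theorem detForm_self (a : A) : Q.detForm a a = 0 := by simp [detForm]

@[simp] theorem detForm_one (a : A) : Q.detForm 1 a = Q.basisA.repr a 1 := by simp [detForm]

theorem detForm_smul (r : R) (a b : A) : Q.detForm (r • a) b = r * Q.detForm a b := by
  simp [detForm]; ring

/-- The bilinear form attached to a functional on `R`. -/
def form (μ : R →ₗ[k] k) : LinearMap.BilinForm k A :=
  LinearMap.mk₂ k (fun a b => μ (Q.detForm a b))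
    (fun a a' b => by rw [← map_add]; congr 1; simp [detForm]; ring)
    (fun c a b => by
      rw [← map_smul]; congr 1
      rw [← IsScalarTower.algebraMap_smul R c a, detForm_smul, Algebra.smul_def])
    (fun a b b' => by rw [← map_add]; congr 1; simp [detForm]; ring)
    (fun c a b => by
      rw [← map_smul]; congr 1
      rw [← IsScalarTower.algebraMap_smul R c b, Algebra.smul_def c (Q.detForm a b)]
      simp [detForm, -algebraMap_smul]; ring)

@[simp] theorem form_apply (μ : R →ₗ[k] k) (a b : A) : Q.form μ a b = μ (Q.detForm a b) := rfl

theorem form_isAlt (μ : R →ₗ[k] k) : (Q.form μ).IsAlt := fun a => by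
  simp [detForm_self]

theorem form_T_mul (μ : R →ₗ[k] k) (a b : A) :
    Q.form μ (Q.T * a) (Q.T * b) = Q.q * Q.form μ a b := by
  rw [form_apply, detForm_T_mul, ← Algebra.smul_def, map_smul]; rfl

/-- Since `T * Tbar = q` is invertible, being a similitude of multiplier `q` amounts to having
`Tbar` as adjoint. -/
theorem apply_T_mul {B : LinearMap.BilinForm k A}
    (hT : ∀ a b, B (Q.T * a) (Q.T * b) = Q.q * B a b) (a b : A) :
    B (Q.T * a) b = B a (Q.Tbar * b) := by
  have h1 : b = Q.T * (Q.q⁻¹ • (Q.Tbar * b)) := by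
    rw [mul_smul_comm, ← mul_assoc, Q.T_mul_Tbar, ← Algebra.smul_def, smul_smul,
      inv_mul_cancel₀ Q.q_ne_zero, one_smul]
  conv_lhs => rw [h1]
  rw [hT, map_smul, smul_eq_mul, ← mul_assoc, mul_inv_cancel₀ Q.q_ne_zero, one_mul]

/-- Every alternating form for which `T` is a similitude of multiplier `q` comes from a functional
on `R`. -/
theorem exists_eq_form {B : LinearMap.BilinForm k A} (hB : B.IsAlt)
    (hT : ∀ a b, B (Q.T * a) (Q.T * b) = Q.q * B a b) : ∃ μ : R →ₗ[k] k, B = Q.form μ := by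
  have hadj := Q.apply_T_mul hT
  have hadj' : ∀ a b, B (Q.Tbar * a) b = B a (Q.T * b) := fun a b => by
    rw [← hB.neg_eq, ← hadj b a, hB.neg_eq]
  have hs : ∀ a b, B (Q.s • a) b = B a (Q.s • b) := fun a b => by
    have h (a : A) : Q.s • a = Q.T * a + Q.Tbar * a := by
      rw [← add_mul, Tbar, add_sub_cancel, Algebra.smul_def]
    rw [h, h, map_add, LinearMap.add_apply, map_add, hadj, hadj', add_comm]
  have hR : ∀ (r : R) (a b : A), B (r • a) b = B a (r • b) := fun r a b => by
    rw [Q.eq_add_smul_s r]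
    simp only [add_smul, map_add, LinearMap.add_apply, smul_assoc, one_smul, map_smul,
      LinearMap.smul_apply, hs]
  -- Self-adjointness of `s` yields only `2 B(1, s) = 0`. Writing `s = T + Tbar`, with `T` and
  -- `Tbar` adjoint to each other, gives the vanishing in characteristic two as well.
  have h11 : ∀ r : R, B 1 (r • 1) = 0 := fun r => by
    have h0 : B 1 (Q.s • (1 : A)) = 0 := by
      have : Q.s • (1 : A) = Q.T * 1 + Q.Tbar * 1 := by
        rw [← add_mul, Tbar, add_sub_cancel, Algebra.smul_def]
      rw [this, map_add, ← hadj', ← hB.neg_eq 1, neg_add_cancel]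
    rw [Q.eq_add_smul_s r]
    simp only [add_smul, map_add, smul_assoc, one_smul, map_smul, h0, hB 1, smul_zero, add_zero]
  have hTT : ∀ r : R, B Q.T (r • Q.T) = 0 := fun r => by
    have := hT 1 (r • 1)
    rwa [h11, mul_zero, mul_one, mul_smul_comm, mul_one] at this
  -- The functional is `r ↦ B(1, r T)`, as forced by `det(1, r T) = r`.
  refine ⟨(B 1).comp ((LinearMap.toSpanSingleton R A Q.T).restrictScalars k), ?_⟩
  ext a b
  rw [form_apply]
  conv_lhs => rw [Q.eq_add_smul_T a, Q.eq_add_smul_T b]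
  have hT1 : ∀ r : R, B Q.T (r • 1) = - B 1 (r • Q.T) := fun r => by
    rw [← hR, ← hB.neg_eq]
  simp only [map_add, LinearMap.add_apply, hR, smul_smul, h11, hTT, hT1]
  simp only [LinearMap.comp_apply, LinearMap.restrictScalars_apply,
    LinearMap.toSpanSingleton_apply, detForm, map_sub]
  rw [mul_comm (Q.basisA.repr a 1)]
  ring

/-- The functional `μ` generates the dual of `R`. -/
def IsGenerator (μ : R →ₗ[k] k) : Prop := ∀ r : R, (∀ r', μ (r * r') = 0) → r = 0

/-- An element `r` with `μ(r R) = 0` puts `r • 1` in the radical of the form. -/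
theorem isGenerator_of_nondegenerate {μ : R →ₗ[k] k} (h : (Q.form μ).Nondegenerate) :
    IsGenerator μ := fun r hr => by
  have := h.1 (r • (1 : A)) fun b => by
    rw [form_apply, detForm_smul, hr]
  simpa using congrArg (fun a => Q.basisA.repr a 0) this

theorem form_nondegenerate {μ : R →ₗ[k] k} (h : IsGenerator μ) :
    (Q.form μ).Nondegenerate := by
  have key : ∀ a, (∀ b, μ (Q.detForm a b) = 0) → a = 0 := fun a ha => by
    have h0 : Q.basisA.repr a 0 = 0 := h _ fun r => by
      simpa [detForm] using ha (r • Q.T)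
    have h1 : Q.basisA.repr a 1 = 0 := h _ fun r => by
      simpa [detForm, mul_comm] using ha (r • 1)
    rw [Q.eq_add_smul_T a, h0, h1, zero_smul, zero_smul, add_zero]
  refine ⟨key, fun b hb => key b fun a => ?_⟩
  rw [← form_apply, ← (Q.form_isAlt μ).neg_eq, hb, neg_zero]

include Q in
theorem moduleFinite : Module.Finite k R := Module.Finite.of_basis Q.basisR

include Q in
-- The map `r ↦ μ(r ·)` from `R` to its dual is injective between spaces of the same dimension.
theorem exists_mul_of_isGenerator {μ : R →ₗ[k] k} (h : IsGenerator μ) (μ' : R →ₗ[k] k) :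
    ∃ u : R, ∀ r, μ' r = μ (u * r) := by
  have := Q.moduleFinite
  let L : R →ₗ[k] Module.Dual k R := (LinearMap.mul k R).compr₂ μ
  have hL : Function.Injective L := (injective_iff_map_eq_zero L).2 fun r hr => h r fun r' => by
    simpa [L] using LinearMap.congr_fun hr r'
  obtain ⟨u, hu⟩ := (LinearMap.injective_iff_surjective_of_finrank_eq_finrank
    (Subspace.dual_finrank_eq (K := k) (V := R)).symm).1 hL μ'
  exact ⟨u, fun r => by rw [← hu]; rfl⟩

include Q in
theorem exists_unit_mul_of_isGenerator {μ μ' : R →ₗ[k] k} (h : IsGenerator μ)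
    (h' : IsGenerator μ') : ∃ u : Rˣ, ∀ r, μ' r = μ (u * r) := by
  obtain ⟨u, hu⟩ := Q.exists_mul_of_isGenerator h μ'
  obtain ⟨v, hv⟩ := Q.exists_mul_of_isGenerator h' μ
  have huv : u * v = 1 := by
    refine sub_eq_zero.1 (h _ fun r => ?_)
    rw [sub_mul, one_mul, map_sub, sub_eq_zero, mul_assoc, ← hu, ← hv]
  exact ⟨⟨u, v, huv, by rw [mul_comm, huv]⟩, hu⟩

/-- Every `r` is a value `det(1, r T)`, so the form determines its multiplier. -/
theorem eq_of_form_eq {μ : R →ₗ[k] k} (h : IsGenerator μ) {u v : R}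
    (huv : ∀ a b, μ (u * Q.detForm a b) = μ (v * Q.detForm a b)) : u = v := by
  refine sub_eq_zero.1 (h _ fun r => ?_)
  have := huv 1 (r • Q.T)
  rw [sub_mul, map_sub, sub_eq_zero]
  simpa using this

/-- The functional `x + y s ↦ y` generates the dual of `R`. -/
theorem isGenerator_coord : IsGenerator (Q.basisR.coord 1) := fun r hr => by
  have h1 : Q.basisR.repr r 1 = 0 := by simpa using hr 1
  have h0 : Q.basisR.repr r 0 = 0 := by
    have := hr Q.s
    rw [Q.eq_add_smul_s r, h1, zero_smul, add_zero, smul_mul_assoc, one_mul, map_smul,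
      ← Q.basisR_one] at this
    simpa using this
  rw [Q.eq_add_smul_s r, h0, h1, zero_smul, zero_smul, add_zero]

end QuadTower

/-! ### Norms and centralizers in a finite quadratic tower -/

/-- The powers of `x` are eventually periodic; an exponent beyond the preperiod and divisible by the
period gives an idempotent. Applied to the discriminant, it splits `R` into an étale part and a part
where the discriminant is nilpotent. -/
theorem exists_isIdempotentElem_pow {M : Type*} [Monoid M] [Finite M] (x : M) :
    ∃ n : ℕ, 0 < n ∧ IsIdempotentElem (x ^ n) := by
  obtain ⟨a, b, hab, h⟩ : ∃ a b : ℕ, a < b ∧ x ^ a = x ^ b := by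
    obtain ⟨a, b, hne, h⟩ := Finite.exists_ne_map_eq_of_infinite (fun n : ℕ => x ^ n)
    rcases hne.lt_or_gt with hlt | hlt
    exacts [⟨a, b, hlt, h⟩, ⟨b, a, hlt, h.symm⟩]
  obtain ⟨d, rfl⟩ := Nat.exists_eq_add_of_lt hab
  have step : ∀ t, x ^ (a + t * (d + 1)) = x ^ a := fun t => by
    induction t with
    | zero => simp
    | succ t ih =>
      rw [add_mul, one_mul, ← add_assoc, pow_add, ih, ← pow_add, ← add_assoc, ← h]
  have hn : a ≤ (a + 1) * (d + 1) := a.le_succ.trans (Nat.le_mul_of_pos_right _ d.succ_pos)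
  obtain ⟨c, hc⟩ := Nat.exists_eq_add_of_le hn
  refine ⟨(a + 1) * (d + 1), Nat.mul_pos a.succ_pos d.succ_pos, ?_⟩
  rw [IsIdempotentElem, ← pow_add]
  conv_lhs => rw [show (a + 1) * (d + 1) + (a + 1) * (d + 1) =
    (a + (a + 1) * (d + 1)) + c by omega]
  rw [pow_add, step, ← pow_add, ← hc]

/-- A nondegenerate binary quadratic form `x² + s x y + q y²` over a finite field represents every
element. -/
theorem exists_binary_quadratic_eq {F : Type*} [Field F] [Finite F] (s q u : F)
    (hD : s ^ 2 - 4 * q ≠ 0) : ∃ x y : F, x ^ 2 + s * x * y + q * y ^ 2 = u := by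
  have := Fintype.ofFinite F
  by_cases hF : ringChar F = 2
  · obtain ⟨x, hx⟩ := FiniteField.isSquare_of_char_two hF u
    exact ⟨x, 0, by rw [hx]; ring⟩
  have h2 : (2 : F) ≠ 0 := Ring.two_ne_zero hF
  have h4 : (4 : F) ≠ 0 := by
    rw [show (4 : F) = 2 * 2 by norm_num]; exact mul_ne_zero h2 h2
  -- Completing the square turns the equation into `a² - c b² = u` with `c ≠ 0`, which is solvable
  -- by counting the values of two quadratic polynomials.
  set c := (s ^ 2 - 4 * q) / 4 with hc
  have hc0 : -c ≠ 0 := neg_ne_zero.2 (div_ne_zero hD h4)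
  obtain ⟨a, b, hab⟩ := FiniteField.exists_root_sum_quadratic (f := X ^ 2)
    (g := C (-c) * X ^ 2 + C 0 * X + C (-u)) (by simp) (degree_quadratic hc0)
    (FiniteField.odd_card_of_char_ne_two hF)
  refine ⟨a - s / 2 * b, b, ?_⟩
  simp only [eval_pow, eval_X, eval_add, eval_mul, eval_C] at hab
  have hc' : 4 * c = s ^ 2 - 4 * q := by rw [hc]; field_simp
  field_simp
  linear_combination 4 * hab + b ^ 2 * hc'

/-- Cayley–Hamilton for multiplication by `n` on a plane. This makes a single Newton correction
exact in `exists_norm_eq`. -/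
theorem sq_eq_zero_of_isNilpotent {k R : Type*} [Field k] [CommRing R] [Algebra k R]
    (b : Module.Basis (Fin 2) k R) {n : R} (hn : IsNilpotent n) : n ^ 2 = 0 := by
  have := Module.Finite.of_basis b
  have h1 : IsNilpotent (LinearMap.mulLeft k n) := by
    rwa [LinearMap.isNilpotent_mulLeft_iff]
  have h2 := h1.charpoly_eq_X_pow_finrank
  have h3 := (LinearMap.mulLeft k n).aeval_self_charpoly
  rw [h2, Module.finrank_eq_card_basis b, Fintype.card_fin, map_pow, aeval_X,
    LinearMap.pow_mulLeft, LinearMap.mulLeft_eq_zero_iff] at h3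
  exact h3

namespace QuadTower

variable {k R A : Type*} [Field k] [CommRing R] [CommRing A] [Algebra k R]
    [Algebra k A] [Algebra R A] [IsScalarTower k R A] (Q : QuadTower k R A)

/-- The discriminant of `A / R`. -/
def disc : R := Q.s ^ 2 - 4 * algebraMap k R Q.q

/-- The norm from `A` to `R`. -/
def norm (a : A) : R := Q.detForm a (Q.T * a)

theorem norm_eq (a : A) : Q.norm a = Q.basisA.repr a 0 ^ 2 +
    Q.s * Q.basisA.repr a 0 * Q.basisA.repr a 1 + algebraMap k R Q.q * Q.basisA.repr a 1 ^ 2 := by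
  rw [norm, detForm, (Q.repr_T_mul a).1, (Q.repr_T_mul a).2]; ring

theorem repr_mul (a b : A) :
    Q.basisA.repr (a * b) 0 = Q.basisA.repr a 0 * Q.basisA.repr b 0 -
        algebraMap k R Q.q * (Q.basisA.repr a 1 * Q.basisA.repr b 1) ∧
      Q.basisA.repr (a * b) 1 = Q.basisA.repr a 0 * Q.basisA.repr b 1 +
        Q.basisA.repr a 1 * (Q.basisA.repr b 0 + Q.s * Q.basisA.repr b 1) := by
  conv => enter [1, 1]; rw [Q.eq_add_smul_T a]
  conv => enter [2, 1]; rw [Q.eq_add_smul_T a]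
  simp only [add_mul, smul_mul_assoc, one_mul, map_add, map_smul, Finsupp.add_apply,
    Finsupp.smul_apply, smul_eq_mul, (Q.repr_T_mul b).1, (Q.repr_T_mul b).2]
  exact ⟨by ring, trivial⟩

/-- Multiplication by `v` is `R`-linear on the free rank two module `A`, and its determinant is the
norm of `v`. -/
theorem detForm_mul (v a b : A) : Q.detForm (v * a) (v * b) = Q.norm v * Q.detForm a b := by
  simp only [norm_eq, detForm, (Q.repr_mul v a).1, (Q.repr_mul v a).2, (Q.repr_mul v b).1,
    (Q.repr_mul v b).2]
  ring

theorem norm_mul (a b : A) : Q.norm (a * b) = Q.norm a * Q.norm b := by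
  rw [norm, mul_left_comm, detForm_mul]; rfl

include Q in
theorem finite_R [Finite k] : Finite R := by
  have := Q.moduleFinite; exact Module.finite_of_finite k

/-- On the part of `R` where `A / R` is étale every unit is a norm. -/
theorem exists_norm_eq [Finite k] {n : ℕ} (hn : 0 < n) (he : IsIdempotentElem (Q.disc ^ n))
    (u : Rˣ) : ∃ v : A, Q.disc ^ n * Q.norm v = Q.disc ^ n * u := by
  have := Q.finite_R
  set e := Q.disc ^ n with hedef
  -- The norm equation is solved in each residue field where the discriminant survives; elsewhere
  -- `e` lies in the maximal ideal and there is nothing to solve.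
  have hloc : ∀ m : MaximalSpectrum R, ∃ x y : R,
      e * (x ^ 2 + Q.s * x * y + algebraMap k R Q.q * y ^ 2 - u) ∈ m.asIdeal := fun m => by
    by_cases hem : Q.disc ∈ m.asIdeal
    · exact ⟨0, 0, Ideal.mul_mem_right _ _ (Ideal.pow_mem_of_mem _ hem _ hn)⟩
    · have := m.isMaximal
      let _ : Field (R ⧸ m.asIdeal) := Ideal.Quotient.field _
      have : Finite (R ⧸ m.asIdeal) := Quotient.finite _
      obtain ⟨x, y, hxy⟩ := exists_binary_quadratic_eq (Ideal.Quotient.mk m.asIdeal Q.s)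
        (Ideal.Quotient.mk m.asIdeal (algebraMap k R Q.q)) (Ideal.Quotient.mk m.asIdeal u)
        (by
          rw [← Ideal.Quotient.eq_zero_iff_mem] at hem
          simpa only [disc, map_sub, map_pow, map_mul, map_ofNat] using hem)
      obtain ⟨x, rfl⟩ := Ideal.Quotient.mk_surjective x
      obtain ⟨y, rfl⟩ := Ideal.Quotient.mk_surjective y
      refine ⟨x, y, Ideal.mul_mem_left _ _ ?_⟩
      rw [← Ideal.Quotient.eq_zero_iff_mem, map_sub, sub_eq_zero, ← hxy]
      simp
  choose x y hxy using hloc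
  have hcop : Pairwise (Function.onFun IsCoprime fun m : MaximalSpectrum R => m.asIdeal) :=
    fun m m' hne => Ideal.isCoprime_of_isMaximal fun h => hne (MaximalSpectrum.ext h)
  obtain ⟨X, hX⟩ := Ideal.exists_forall_sub_mem_ideal hcop x
  obtain ⟨Y, hY⟩ := Ideal.exists_forall_sub_mem_ideal hcop y
  set v : A := X • 1 + Y • Q.T with hv
  have hNv : Q.norm v = X ^ 2 + Q.s * X * Y + algebraMap k R Q.q * Y ^ 2 := by
    rw [norm_eq, hv]; simp
  -- The Chinese remainder theorem has glued the local solutions into `v`; the error `ν` lies in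
  -- every prime ideal, so it is nilpotent and `ν ^ 2 = 0`.
  set ν := e * (Q.norm v - u) with hν
  have hnil : IsNilpotent ν := by
    rw [nilpotent_iff_mem_prime]
    intro J hJ
    have hJm : J.IsMaximal := Ideal.isMaximal_of_isPrime J
    have h1 := hxy ⟨J, hJm⟩
    rw [hν, hNv]
    have h2 := hX ⟨J, hJm⟩
    have h3 := hY ⟨J, hJm⟩
    simp only [← Ideal.Quotient.eq_zero_iff_mem, map_sub, sub_eq_zero, map_mul, map_add,
      map_pow] at h1 h2 h3 ⊢
    rw [h2, h3]; exact h1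
  have hν2 : ν ^ 2 = 0 := sq_eq_zero_of_isNilpotent Q.basisR hnil
  have he' : e * e = e := he
  set c := -(ν * (↑u⁻¹ : R) * Q.disc ^ (n - 1)) with hc
  have hc2 : c ^ 2 = 0 := by
    rw [hc, neg_sq, mul_pow, mul_pow, hν2, zero_mul, zero_mul]
  have hcD : c * Q.disc = -(ν * (↑u⁻¹ : R)) * e := by
    rw [hc, hedef]
    conv_rhs => rw [← Nat.sub_add_cancel hn]
    rw [pow_succ]; ring
  have hνe : e * ν = ν := by rw [hν, ← mul_assoc, he']
  have huu : (u : R) * (↑u⁻¹ : R) = 1 := u.mul_inv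
  -- The element `-2q + sT` has trace `disc`, so `N(1 + c(-2q + sT)) = 1 + c disc` because `c ^ 2 =
  -- 0`. The choice of `c` makes `c disc = -ν u⁻¹ e`, which cancels the error.
  set w : A := (1 + c * (-2 * algebraMap k R Q.q)) • 1 + (c * Q.s) • Q.T with hw
  have hNw : Q.norm w = 1 + c * Q.disc := by
    rw [norm_eq, hw]
    simp only [map_add, map_smul, Finsupp.add_apply, Finsupp.smul_apply, repr_one_zero,
      repr_one_one, repr_T_zero, repr_T_one, smul_eq_mul, disc]
    linear_combination (4 * algebraMap k R Q.q ^ 2 - algebraMap k R Q.q * Q.s ^ 2) * hc2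
  refine ⟨v * w, ?_⟩
  rw [norm_mul, hNw, hcD]
  have hev : e * Q.norm v = e * u + ν := by rw [hν]; ring
  clear_value e ν
  linear_combination (1 - ν * ↑u⁻¹ * e) * hev - ν * e * e * huu - hνe - ν * he' -
    e * ↑u⁻¹ * hν2

/-- On the part of `R` where `A / R` is not étale the semisimple part of `T` lies in `R`. -/
theorem exists_smul_pow_eq (ℓ : ℕ) [hℓ : Fact ℓ.Prime] [CharP k ℓ] {n : ℕ} {e : R}
    (he : e * Q.disc ^ n = 0) {N : ℕ} (hN : 2 * n < ℓ ^ N) :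
    ∃ r : R, e • Q.T ^ ℓ ^ N = r • (1 : A) := by
  rcases subsingleton_or_nontrivial A with _ | _
  · exact ⟨0, Subsingleton.elim _ _⟩
  have : Nontrivial R := (algebraMap R A).domain_nontrivial
  have : CharP A ℓ := charP_of_injective_algebraMap (algebraMap k A).injective ℓ
  have : CharP R ℓ := charP_of_injective_algebraMap (algebraMap k R).injective ℓ
  by_cases h2 : ℓ = 2
  · subst h2
    have h20 : (2 : R) = 0 := CharP.cast_eq_zero R 2
    have hD : Q.disc = Q.s ^ 2 := by
      rw [disc]; linear_combination -2 * algebraMap k R Q.q * h20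
    -- In characteristic two, repeated squaring multiplies the coefficient of `T` by powers of `s`.
    -- Since `disc = s²`, that coefficient is killed by `e` as soon as `2 ^ N - 1 ≥ 2 n`.
    have key : ∀ j : ℕ, ∃ r : R, Q.T ^ 2 ^ j = Q.s ^ (2 ^ j - 1) • Q.T + r • (1 : A) := fun j => by
      induction j with
      | zero => exact ⟨0, by simp⟩
      | succ j ih =>
        obtain ⟨r, hr⟩ := ih
        refine ⟨r ^ 2 - Q.s ^ (2 * (2 ^ j - 1)) * algebraMap k R Q.q, ?_⟩
        rw [pow_succ, pow_mul, hr, add_pow_char, show 2 ^ j * 2 - 1 = 2 * (2 ^ j - 1) + 1 by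
          have := Nat.one_le_two_pow (n := j); omega]
        simp only [Algebra.smul_def, map_sub, map_mul, map_pow, ← IsScalarTower.algebraMap_apply]
        linear_combination (algebraMap R A Q.s ^ (2 ^ j - 1)) ^ 2 * Q.T_mul_T
    obtain ⟨r, hr⟩ := key N
    obtain ⟨c, hc⟩ := Nat.exists_eq_add_of_lt hN
    refine ⟨e * r, ?_⟩
    rw [hr, smul_add, smul_smul, smul_smul, hc, show 2 * n + c + 1 - 1 = 2 * n + c by omega,
      pow_add, pow_mul, ← hD, ← mul_assoc, he, zero_mul, zero_smul, zero_add]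
  · have h2k : (2 : k) ≠ 0 := by
      have : ¬ ℓ ∣ 2 := fun h => h2 ((Nat.prime_dvd_prime_iff_eq hℓ.out Nat.prime_two).1 h)
      rwa [← CharP.cast_eq_zero_iff k ℓ] at this
    -- For odd `ℓ`, a high power of `2T - s` is killed by `e`, and Frobenius then identifies `e (2T)
    -- ^ ℓ ^ N` with `e s ^ ℓ ^ N`.
    have hsq : (2 * Q.T - algebraMap R A Q.s) ^ 2 = algebraMap R A Q.disc := by
      simp only [disc, map_sub, map_mul, map_pow, map_ofNat, ← IsScalarTower.algebraMap_apply]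
      linear_combination 4 * Q.T_mul_T
    have h0 : e • (2 * Q.T - algebraMap R A Q.s) ^ ℓ ^ N = 0 := by
      obtain ⟨c, hc⟩ := Nat.exists_eq_add_of_lt hN
      rw [hc, add_assoc, pow_add, pow_mul, hsq, ← map_pow, ← smul_mul_assoc,
        Algebra.smul_def, ← map_mul, he, map_zero, zero_mul]
    rw [sub_pow_char_pow, mul_pow, smul_sub, sub_eq_zero] at h0
    have hinv : algebraMap k A ((2⁻¹ : k) ^ ℓ ^ N) * 2 ^ ℓ ^ N = 1 := by
      rw [← map_ofNat (algebraMap k A) 2, ← map_pow, ← map_mul, ← mul_pow, inv_mul_cancel₀ h2k,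
        one_pow, map_one]
    refine ⟨algebraMap k R ((2⁻¹ : k) ^ ℓ ^ N) * e * Q.s ^ ℓ ^ N, ?_⟩
    simp only [Algebra.smul_def, map_mul, map_pow, ← IsScalarTower.algebraMap_apply] at h0 hinv ⊢
    linear_combination (algebraMap k A 2⁻¹) ^ ℓ ^ N * h0 - algebraMap R A e * Q.T ^ ℓ ^ N * hinv

/-- The centralizer of the semisimple part of `T` in `GL_R(A)` surjects onto `Rˣ` under the
determinant. -/
theorem exists_equiv_detForm_eq [Finite k] (ℓ : ℕ) [hℓ : Fact ℓ.Prime] [CharP k ℓ] {M : ℕ}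
    (hM : 0 < M) (hT : (Q.T ^ ℓ ^ M) ^ ℓ ^ M = Q.T ^ ℓ ^ M) (u : Rˣ) :
    ∃ ψ : A ≃ₗ[k] A, (∀ a b, Q.detForm (ψ a) (ψ b) = u * Q.detForm a b) ∧
      ∀ a, ψ (Q.T ^ ℓ ^ M * a) = Q.T ^ ℓ ^ M * ψ a := by
  have := Q.finite_R
  have := Q.moduleFinite
  have : Module.Finite R A := Module.Finite.of_basis Q.basisA
  have : Module.Finite k A := Module.Finite.trans R A
  obtain ⟨n, hn, he⟩ := exists_isIdempotentElem_pow Q.disc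
  obtain ⟨v, hv⟩ := Q.exists_norm_eq hn he u
  -- Iterating the idempotent power map makes the exponent exceed `2 n` without changing the
  -- semisimple part.
  have hTj : ∀ j : ℕ, Q.T ^ ℓ ^ (M * (j + 1)) = Q.T ^ ℓ ^ M := fun j => by
    induction j with
    | zero => simp
    | succ j ih => rw [mul_add, mul_one, pow_add, pow_mul, ih, hT]
  obtain ⟨r, hr⟩ := Q.exists_smul_pow_eq ℓ (n := n) (e := 1 - Q.disc ^ n) (N := M * (2 * n + 1))
    (by rw [sub_mul, one_mul, he.eq, sub_self]) (by
      have h1 : 2 * n + 1 ≤ M * (2 * n + 1) := Nat.le_mul_of_pos_left _ hM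
      exact (Nat.lt_succ_self _).trans_le (h1.trans (Nat.lt_pow_self hℓ.out.one_lt).le))
  rw [hTj] at hr
  set e := Q.disc ^ n with hedef
  have he' : e * e = e := he
  let δ : A →ₗ[R] A := Q.basisA.constr R ![1, (u : R) • Q.T]
  have hδ : ∀ a, δ a = Q.basisA.repr a 0 • (1 : A) + (u * Q.basisA.repr a 1) • Q.T := fun a => by
    simp [δ, Module.Basis.constr_apply_fintype, Fin.sum_univ_two, smul_smul, mul_comm]
  have hδd : ∀ a b, Q.detForm (δ a) (δ b) = u * Q.detForm a b := fun a b => by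
    simp only [detForm, hδ, map_add, map_smul, Finsupp.add_apply, Finsupp.smul_apply,
      repr_one_zero, repr_one_one, repr_T_zero, repr_T_one, smul_eq_mul]
    ring
  -- On the étale part multiplication by `v`, of norm `u`, commutes with all of `A`; on the other
  -- part the semisimple part of `T` is a scalar and `δ = diag(1, u)` commutes with it. Cross terms
  -- in the determinant vanish since `e (1 - e) = 0`.
  let ψ : A →ₗ[R] A := e • LinearMap.mulLeft R v + (1 - e) • δ
  have hψ : ∀ a, ψ a = e • (v * a) + (1 - e) • δ a := fun a => rfl
  have hψd : ∀ a b, Q.detForm (ψ a) (ψ b) = u * Q.detForm a b := fun a b => by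
    have h : Q.detForm (ψ a) (ψ b) =
        e * Q.detForm (v * a) (v * b) + (1 - e) * Q.detForm (δ a) (δ b) := by
      simp only [detForm, hψ, map_add, map_smul, Finsupp.add_apply, Finsupp.smul_apply, smul_eq_mul]
      generalize Q.basisA.repr (v * a) 0 = x1
      generalize Q.basisA.repr (v * b) 0 = x2
      generalize Q.basisA.repr (v * a) 1 = x3
      generalize Q.basisA.repr (v * b) 1 = x4
      generalize Q.basisA.repr (δ a) 0 = y1
      generalize Q.basisA.repr (δ b) 0 = y2
      generalize Q.basisA.repr (δ a) 1 = y3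
      generalize Q.basisA.repr (δ b) 1 = y4
      linear_combination (x1 * x4 - x2 * x3 + y1 * y4 - y2 * y3 - x1 * y4 - y1 * x4 + x2 * y3 +
        y2 * x3) * he'
    rw [h, detForm_mul, hδd, ← mul_assoc, hv]
    ring
  have hinj : Function.Injective ψ := (injective_iff_map_eq_zero ψ).2 fun a ha => by
    have h : ∀ b, Q.detForm a b = 0 := fun b => by
      have := hψd a b
      rw [ha] at this
      rw [← Units.mul_right_eq_zero u, ← this]
      simp [detForm]
    have h0 := h 1
    have h1 := h Q.T
    simp only [detForm, repr_one_zero, repr_one_one, repr_T_zero, repr_T_one] at h0 h1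
    rw [Q.eq_add_smul_T a, show Q.basisA.repr a 0 = 0 by simpa using h1,
      show Q.basisA.repr a 1 = 0 by simpa using h0, zero_smul, zero_smul, add_zero]
  refine ⟨LinearEquiv.ofInjectiveEndo (ψ.restrictScalars k) hinj, hψd, fun a => ?_⟩
  change ψ _ = _ * ψ a
  have hδT : (1 - e) • δ (Q.T ^ ℓ ^ M * a) = Q.T ^ ℓ ^ M * ((1 - e) • δ a) := by
    rw [← map_smul, ← smul_mul_assoc, hr, smul_mul_assoc, one_mul, map_smul, mul_smul_comm,
      ← smul_mul_assoc, hr, smul_mul_assoc, one_mul]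
  rw [hψ, hψ, hδT, mul_add, mul_left_comm, mul_smul_comm e]

end QuadTower

/-! ### Similitudes -/

section Similitudes

variable {k : Type*} [Field k]

/-- The standard symplectic form on `k⁴`, as a bilinear form. -/
def stdForm (k : Type*) [Field k] : LinearMap.BilinForm k (Fin 2 ⊕ Fin 2 → k) :=
  Matrix.toBilin' (J k)

/-- `GL₄(k)` as the group of linear automorphisms of `k⁴`. -/
def glEquiv (k : Type*) [Field k] :
    GL (Fin 2 ⊕ Fin 2) k ≃* ((Fin 2 ⊕ Fin 2 → k) ≃ₗ[k] (Fin 2 ⊕ Fin 2 → k)) :=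
  Matrix.GeneralLinearGroup.toLin.trans (LinearMap.GeneralLinearGroup.generalLinearEquiv k _)

theorem glEquiv_apply (γ : GL (Fin 2 ⊕ Fin 2) k) (v : Fin 2 ⊕ Fin 2 → k) :
    glEquiv k γ v = γ.1.mulVec v := rfl

theorem mulVec_glEquiv_symm (g : (Fin 2 ⊕ Fin 2 → k) ≃ₗ[k] (Fin 2 ⊕ Fin 2 → k))
    (v : Fin 2 ⊕ Fin 2 → k) : ((glEquiv k).symm g).1.mulVec v = g v := by
  rw [← glEquiv_apply, MulEquiv.apply_symm_apply]

theorem gl_ext {γ δ : GL (Fin 2 ⊕ Fin 2) k} (h : ∀ v, γ.1.mulVec v = δ.1.mulVec v) : γ = δ :=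
  (glEquiv k).injective (LinearEquiv.ext h)

theorem J_mul_J : J k * J k = -1 := by
  rw [J, Matrix.fromBlocks_multiply]
  simp [← Matrix.fromBlocks_one, Matrix.fromBlocks_neg]

theorem isUnit_J : IsUnit (J k) :=
  IsUnit.of_mul_eq_one (-J k) (by rw [mul_neg, J_mul_J, neg_neg])

theorem stdForm_nondegenerate : (stdForm k).Nondegenerate := by
  rw [stdForm, LinearMap.BilinForm.nondegenerate_toBilin'_iff_det_ne_zero]
  exact ((Matrix.isUnit_iff_isUnit_det _).1 isUnit_J).ne_zero

theorem stdForm_apply (v w : Fin 2 ⊕ Fin 2 → k) :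
    stdForm k v w = v (.inl 0) * w (.inr 0) + v (.inl 1) * w (.inr 1) -
      v (.inr 0) * w (.inl 0) - v (.inr 1) * w (.inl 1) := by
  rw [stdForm, Matrix.toBilin'_apply']
  simp [J, dotProduct, Matrix.mulVec, Fin.sum_univ_two, Matrix.one_apply]
  ring

theorem stdForm_isAlt : (stdForm k).IsAlt := fun v => by
  rw [stdForm_apply]; ring

theorem mem_GSpMult_iff {m : k} {γ : GL (Fin 2 ⊕ Fin 2) k} :
    γ ∈ GSpMult k m ↔ ∀ v w, stdForm k (γ.1.mulVec v) (γ.1.mulVec w) = m * stdForm k v w := by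
  have h : ∀ v w, stdForm k (γ.1.mulVec v) (γ.1.mulVec w) =
      Matrix.toBilin' (γ.1.transpose * J k * γ.1) v w := fun v w => by
    rw [stdForm, Matrix.toBilin'_apply', Matrix.toBilin'_apply', ← Matrix.mulVec_mulVec,
      ← Matrix.mulVec_mulVec, Matrix.dotProduct_mulVec v γ.1.transpose, Matrix.vecMul_transpose]
  simp only [h]
  have h2 : ∀ v w, m * stdForm k v w = Matrix.toBilin' (m • J k) v w := fun v w => by
    rw [map_smul]; rfl
  simp only [h2]
  constructor
  · intro hγ v w
    rw [show γ.1.transpose * J k * γ.1 = m • J k from hγ]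
  · intro hγ
    exact Matrix.toBilin'.injective (LinearMap.ext₂ hγ)

theorem mul_mem_GSpMult {a b : k} {γ δ : GL (Fin 2 ⊕ Fin 2) k} (hγ : γ ∈ GSpMult k a)
    (hδ : δ ∈ GSpMult k b) : γ * δ ∈ GSpMult k (a * b) := by
  rw [mem_GSpMult_iff] at *
  intro v w
  rw [Units.val_mul, ← Matrix.mulVec_mulVec, ← Matrix.mulVec_mulVec, hγ, hδ, mul_assoc]

theorem one_mem_GSpMult : (1 : GL (Fin 2 ⊕ Fin 2) k) ∈ GSpMult k 1 := by
  rw [mem_GSpMult_iff]; simp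

theorem pow_mem_GSpMult {a : k} {γ : GL (Fin 2 ⊕ Fin 2) k} (hγ : γ ∈ GSpMult k a) (n : ℕ) :
    γ ^ n ∈ GSpMult k (a ^ n) := by
  induction n with
  | zero => simpa using one_mem_GSpMult
  | succ n ih => rw [pow_succ, pow_succ]; exact mul_mem_GSpMult ih hγ

theorem inv_mul_mem_GSpMult_one {a : k} (ha : a ≠ 0) {γ δ : GL (Fin 2 ⊕ Fin 2) k}
    (hγ : γ ∈ GSpMult k a) (hδ : δ ∈ GSpMult k a) : γ⁻¹ * δ ∈ GSpMult k 1 := by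
  rw [mem_GSpMult_iff] at *
  intro v w
  have h := hγ ((γ⁻¹ * δ).1.mulVec v) ((γ⁻¹ * δ).1.mulVec w)
  rw [Matrix.mulVec_mulVec, Matrix.mulVec_mulVec, ← Units.val_mul, mul_inv_cancel_left, hδ] at h
  rw [one_mul]
  exact (mul_left_cancel₀ ha h).symm

theorem GSpMult_unique {a b : k} {γ : GL (Fin 2 ⊕ Fin 2) k} (ha : γ ∈ GSpMult k a)
    (hb : γ ∈ GSpMult k b) : a = b := by
  rw [mem_GSpMult_iff] at ha hb
  have h := (ha (Pi.single (.inl 0) 1) (Pi.single (.inr 0) 1)).symm.trans (hb _ _)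
  simpa [stdForm_apply] using h

end Similitudes

/-! ### Trivializations of the tower and their double count -/

namespace QuadTower

section

variable {k R A : Type*} [Field k] [CommRing R] [CommRing A] [Algebra k R]
    [Algebra k A] [Algebra R A] [IsScalarTower k R A] (Q : QuadTower k R A)

include Q in
theorem moduleFinite_A : Module.Finite k A := by
  have := Q.moduleFinite
  have : Module.Finite R A := Module.Finite.of_basis Q.basisA
  exact Module.Finite.trans R A

include Q in
theorem finrank_A : Module.finrank k A = 4 := by
  rw [Module.finrank_eq_card_basis (Q.basisR.smulTower Q.basisA)]; simp

include Q in
theorem finite_A [Finite k] : Finite A := by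
  have := Q.moduleFinite_A; exact Module.finite_of_finite k

/-- In the finite ring `A` the unit `T` has finite order, so `Tbar = q T⁻¹` is a polynomial in `T`;
hence so are `s = T + Tbar` and all of `R`. -/
theorem adjoin_T_eq_top [Finite k] : Algebra.adjoin k {Q.T} = ⊤ := by
  have := Q.finite_A
  have hT : Q.T ∈ Algebra.adjoin k {Q.T} := Algebra.self_mem_adjoin_singleton k _
  have hTbar : Q.Tbar ∈ Algebra.adjoin k {Q.T} := by
    obtain ⟨τ, hτ⟩ := Q.isUnit_T
    have h1 : Q.T * Q.T ^ (orderOf τ - 1) = 1 := by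
      rw [← pow_succ', Nat.sub_add_cancel (orderOf_pos τ), ← hτ, ← Units.val_pow_eq_pow_val,
        pow_orderOf_eq_one, Units.val_one]
    have h2 : Q.Tbar = algebraMap k A Q.q * Q.T ^ (orderOf τ - 1) := by
      rw [← Q.T_mul_Tbar, mul_right_comm, h1, one_mul]
    rw [h2]
    exact mul_mem (algebraMap_mem _ _) (pow_mem hT _)
  have hs : algebraMap R A Q.s ∈ Algebra.adjoin k {Q.T} := by
    have : algebraMap R A Q.s = Q.T + Q.Tbar := by rw [Tbar]; ring
    rw [this]; exact add_mem hT hTbar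
  have hR : ∀ r : R, algebraMap R A r ∈ Algebra.adjoin k {Q.T} := fun r => by
    rw [Q.eq_add_smul_s r]
    simp only [Algebra.smul_def, map_add, map_mul, ← IsScalarTower.algebraMap_apply, mul_one]
    exact add_mem (algebraMap_mem _ _) (mul_mem (algebraMap_mem _ _) hs)
  refine eq_top_iff.2 fun a _ => ?_
  rw [Q.eq_add_smul_T a, Algebra.smul_def, Algebra.smul_def, mul_one]
  exact add_mem (hR _) (mul_mem (hR _) hT)

/-- A linear map commuting with `T` is `A`-linear. -/
theorem map_mul_of_map_T_mul [Finite k] {W : Type*} [AddCommGroup W] [Module k W]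
    (φ ψ : A →ₗ[k] W) (g : W →ₗ[k] W) (hφ : ∀ a, φ (Q.T * a) = g (φ a))
    (hψ : ∀ a, ψ (Q.T * a) = g (ψ a)) (h1 : φ 1 = ψ 1) : φ = ψ := by
  let S : Submodule k A := LinearMap.ker (φ - ψ)
  have hS : ∀ a ∈ S, Q.T * a ∈ S := fun a ha => by
    simp only [S, LinearMap.mem_ker, LinearMap.sub_apply, sub_eq_zero] at ha ⊢
    rw [hφ, hψ, ha]
  have key : ∀ a ∈ Algebra.adjoin k {Q.T}, ∀ b ∈ S, a * b ∈ S := fun a ha => by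
    induction ha using Algebra.adjoin_induction with
    | mem x hx => rw [Set.mem_singleton_iff.1 hx]; exact hS
    | algebraMap r => intro b hb; rw [← Algebra.smul_def]; exact S.smul_mem _ hb
    | add x y _ _ hx hy => intro b hb; rw [add_mul]; exact S.add_mem (hx b hb) (hy b hb)
    | mul x y _ _ hx hy => intro b hb; rw [mul_assoc]; exact hx _ (hy b hb)
  have h1S : (1 : A) ∈ S := by simp [S, h1]
  ext a
  have := key a (by rw [Q.adjoin_T_eq_top]; trivial) 1 h1S
  rw [mul_one] at this
  simpa [S, sub_eq_zero] using this

theorem pow_mulVec {γ : GL (Fin 2 ⊕ Fin 2) k} {φ : A ≃ₗ[k] (Fin 2 ⊕ Fin 2 → k)} {T : A}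
    (h : ∀ a, γ.1.mulVec (φ a) = φ (T * a)) (n : ℕ) (a : A) :
    (γ ^ n).1.mulVec (φ a) = φ (T ^ n * a) := by
  induction n with
  | zero => simp
  | succ n ih =>
    rw [pow_succ', Units.val_mul, ← Matrix.mulVec_mulVec, ih, h, pow_succ', mul_assoc]

/-- The similitudes of multiplier `q` which make `k⁴` a free `A`-module of rank one. -/
def freeSimilitudes : Set (GL (Fin 2 ⊕ Fin 2) k) :=
  {γ | γ ∈ GSpMult k Q.q ∧ ∃ φ : A ≃ₗ[k] (Fin 2 ⊕ Fin 2 → k), ∀ a, γ.1.mulVec (φ a) = φ (Q.T * a)}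

/-- The trivializations `A ≃ k⁴` for which `T` is a similitude of multiplier `q`. -/
def Trivialization : Type _ :=
  {φ : A ≃ₗ[k] (Fin 2 ⊕ Fin 2 → k) //
    ∀ a b, stdForm k (φ (Q.T * a)) (φ (Q.T * b)) = Q.q * stdForm k (φ a) (φ b)}

theorem exists_functional (φ : Q.Trivialization) :
    ∃ μ : R →ₗ[k] k, IsGenerator μ ∧ ∀ a b, stdForm k (φ.1 a) (φ.1 b) = μ (Q.detForm a b) := by
  let B : LinearMap.BilinForm k A := (stdForm k).compl₁₂ φ.1.toLinearMap φ.1.toLinearMap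
  have hB : ∀ a b, B a b = stdForm k (φ.1 a) (φ.1 b) := fun _ _ => rfl
  obtain ⟨μ, hμ⟩ := Q.exists_eq_form (B := B) (fun a => stdForm_isAlt _) φ.2
  refine ⟨μ, Q.isGenerator_of_nondegenerate ?_, fun a b => by rw [← hB, hμ]; rfl⟩
  rw [← hμ]
  refine ⟨fun a ha => ?_, fun a ha => ?_⟩
  · refine φ.1.map_eq_zero_iff.1 (stdForm_nondegenerate.1 _ fun v => ?_)
    simpa [hB] using ha (φ.1.symm v)
  · refine φ.1.map_eq_zero_iff.1 (stdForm_nondegenerate.2 _ fun v => ?_)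
    simpa [hB] using ha (φ.1.symm v)

theorem mul_mem_freeSimilitudes_iff {γ : GL (Fin 2 ⊕ Fin 2) k}
    {φ : A ≃ₗ[k] (Fin 2 ⊕ Fin 2 → k)} (h : ∀ a, γ.1.mulVec (φ a) = φ (Q.T * a)) :
    γ ∈ GSpMult k Q.q ↔
      ∀ a b, stdForm k (φ (Q.T * a)) (φ (Q.T * b)) = Q.q * stdForm k (φ a) (φ b) := by
  rw [mem_GSpMult_iff]
  refine ⟨fun H a b => by rw [← h, ← h, H], fun H v w => ?_⟩
  have := H (φ.symm v) (φ.symm w)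
  rwa [← h, ← h, φ.apply_symm_apply, φ.apply_symm_apply] at this

/-- Sending `φ` to `φ T φ⁻¹` has `Aˣ`-torsors as fibres: trivializations with the same `γ` differ by
an `A`-linear automorphism of `A`, which is multiplication by a unit. -/
theorem card_trivialization_eq [Finite k] :
    Nat.card Q.Trivialization = Q.freeSimilitudes.ncard * Nat.card Aˣ := by
  choose φ hφ using fun γ : Q.freeSimilitudes => γ.2.2
  let mulEquiv (a : Aˣ) : A ≃ₗ[k] A := LinearEquiv.ofLinearMap (LinearMap.mulLeft k (a : A))
    (LinearMap.mulLeft k (↑a⁻¹ : A)) (by ext; simp) (by ext; simp)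
  let F : Q.freeSimilitudes × Aˣ → Q.Trivialization := fun x =>
    ⟨(mulEquiv x.2).trans (φ x.1), fun a b => by
      have := (Q.mul_mem_freeSimilitudes_iff (hφ x.1)).1 x.1.2.1 (x.2 * a) (x.2 * b)
      rwa [mul_left_comm, mul_left_comm Q.T] at this⟩
  have hF : ∀ x a, (F x).1 a = φ x.1 (x.2 * a) := fun _ _ => rfl
  have hFT : ∀ x a, x.1.1.1.mulVec ((F x).1 a) = (F x).1 (Q.T * a) := fun x a => by
    rw [hF, hF, hφ, mul_left_comm]
  have hbij : Function.Bijective F := by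
    constructor
    · rintro x y hxy
      have h1 : x.1 = y.1 := by
        refine Subtype.ext (gl_ext fun v => ?_)
        have hx := hFT x ((F x).1.symm v)
        have hy := hFT y ((F x).1.symm v)
        rw [← hxy, LinearEquiv.apply_symm_apply] at hy
        rw [LinearEquiv.apply_symm_apply] at hx
        rw [hx, hy]
      refine Prod.ext h1 (Units.ext ?_)
      have h2 : (F x).1 1 = (F y).1 1 := by rw [hxy]
      rw [hF, hF, h1, mul_one, mul_one] at h2
      exact (φ y.1).injective h2
    · intro ψ
      let γ : GL (Fin 2 ⊕ Fin 2) k := (glEquiv k).symm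
        ((ψ.1.symm.trans (mulEquiv Q.isUnit_T.unit)).trans ψ.1)
      have hγ : ∀ a, γ.1.mulVec (ψ.1 a) = ψ.1 (Q.T * a) := fun a => by
        rw [mulVec_glEquiv_symm]; simp [mulEquiv]
      have hγX : γ ∈ Q.freeSimilitudes :=
        ⟨(Q.mul_mem_freeSimilitudes_iff hγ).2 ψ.2, ψ.1, hγ⟩
      let a := (φ ⟨γ, hγX⟩).symm (ψ.1 1)
      have hψ : ∀ b, ψ.1 b = φ ⟨γ, hγX⟩ (a * b) := fun b => by
        have := Q.map_mul_of_map_T_mul ψ.1.toLinearMap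
          ((φ ⟨γ, hγX⟩).toLinearMap ∘ₗ LinearMap.mulLeft k a) (glEquiv k γ).toLinearMap
          (fun a => (hγ a).symm) (fun b => by
            simp only [LinearMap.comp_apply, LinearMap.mulLeft_apply, LinearEquiv.coe_coe,
              glEquiv_apply, hφ ⟨γ, hγX⟩, mul_left_comm]) (by simp [a])
        exact LinearMap.congr_fun this b
      have ha : IsUnit a := by
        refine IsUnit.of_mul_eq_one (ψ.1.symm (φ ⟨γ, hγX⟩ 1)) ?_
        apply (φ ⟨γ, hγX⟩).injective
        rw [← hψ, LinearEquiv.apply_symm_apply]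
      refine ⟨(⟨γ, hγX⟩, ha.unit), Subtype.ext (LinearEquiv.ext fun b => ?_)⟩
      rw [hF, hψ]; rfl
  rw [← Nat.card_congr (Equiv.ofBijective F hbij), Nat.card_prod, Nat.card_coe_set_eq]

end

section PrimeField

variable {ℓ : ℕ} [hℓ : Fact ℓ.Prime] {R A : Type*} [CommRing R] [CommRing A] [Algebra (ZMod ℓ) R]
    [Algebra (ZMod ℓ) A] [Algebra R A] [IsScalarTower (ZMod ℓ) R A] (Q : QuadTower (ZMod ℓ) R A)

/-- Two trivializations differ by a symplectic transformation, after a modification which commutes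
with the semisimple part of `T`. -/
theorem exists_symplectic_comp {M : ℕ} (hM : 0 < M)
    (hT : (Q.T ^ ℓ ^ M) ^ ℓ ^ M = Q.T ^ ℓ ^ M) (φ φ₀ : Q.Trivialization) :
    ∃ ψ : A ≃ₗ[ZMod ℓ] A, (∀ a, ψ (Q.T ^ ℓ ^ M * a) = Q.T ^ ℓ ^ M * ψ a) ∧
      ∃ g ∈ GSpMult (ZMod ℓ) 1, ∀ a, g.1.mulVec (φ.1 a) = φ₀.1 (ψ a) := by
  obtain ⟨μ, hμ, hφ⟩ := Q.exists_functional φ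
  obtain ⟨μ₀, hμ₀, hφ₀⟩ := Q.exists_functional φ₀
  obtain ⟨u, hu⟩ := Q.exists_unit_mul_of_isGenerator hμ₀ hμ
  obtain ⟨ψ, hψd, hψT⟩ := Q.exists_equiv_detForm_eq ℓ hM hT u
  refine ⟨ψ, hψT, (glEquiv _).symm ((φ.1.symm.trans ψ).trans φ₀.1), ?_, fun a => ?_⟩
  · rw [mem_GSpMult_iff]
    intro v w
    rw [mulVec_glEquiv_symm, mulVec_glEquiv_symm]
    simp only [LinearEquiv.trans_apply]
    rw [hφ₀, hψd, ← hu, ← hφ, φ.1.apply_symm_apply, φ.1.apply_symm_apply, one_mul]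
  · rw [mulVec_glEquiv_symm]; simp

/-- The pulled-back form is `μ₀(u det)` for a unique unit `u`, and the trivializations with a given
`u` form an `Sp₄`-torsor, based at `φ₀ ∘ ψ u`. Translation by `γ₀⁻¹` identifies the similitudes of
multiplier `q` with `Sp₄`. -/
theorem card_trivialization_eq' {M : ℕ} (hM : 0 < M)
    (hT : (Q.T ^ ℓ ^ M) ^ ℓ ^ M = Q.T ^ ℓ ^ M) (φ₀ : Q.Trivialization)
    {γ₀ : GL (Fin 2 ⊕ Fin 2) (ZMod ℓ)} (hγ₀ : γ₀ ∈ GSpMult (ZMod ℓ) Q.q) :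
    Nat.card Q.Trivialization = (GSpMult (ZMod ℓ) Q.q).ncard * Nat.card Rˣ := by
  obtain ⟨μ₀, hμ₀, hφ₀⟩ := Q.exists_functional φ₀
  choose ψ hψd hψT using Q.exists_equiv_detForm_eq ℓ hM hT
  have hinv : ∀ h : GSpMult (ZMod ℓ) Q.q, γ₀⁻¹ * h.1 ∈ GSpMult (ZMod ℓ) 1 := fun h =>
    inv_mul_mem_GSpMult_one Q.q_ne_zero hγ₀ h.2
  have hform : ∀ (h : GSpMult (ZMod ℓ) Q.q) (u : Rˣ) (a b : A),
      stdForm (ZMod ℓ) (glEquiv _ (γ₀⁻¹ * h.1) (φ₀.1 (ψ u a)))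
        (glEquiv _ (γ₀⁻¹ * h.1) (φ₀.1 (ψ u b))) = μ₀ (u * Q.detForm a b) := fun h u a b => by
    rw [glEquiv_apply, glEquiv_apply, mem_GSpMult_iff.1 (hinv h), one_mul, hφ₀, hψd]
  let F : GSpMult (ZMod ℓ) Q.q × Rˣ → Q.Trivialization := fun x =>
    ⟨((ψ x.2).trans φ₀.1).trans (glEquiv _ (γ₀⁻¹ * x.1.1)), fun a b => by
      simp only [LinearEquiv.trans_apply]
      rw [hform, hform, detForm_T_mul, mul_left_comm, ← Algebra.smul_def, map_smul, smul_eq_mul]⟩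
  have hF : ∀ x a, (F x).1 a = glEquiv _ (γ₀⁻¹ * x.1.1) (φ₀.1 (ψ x.2 a)) := fun _ _ => rfl
  have hbij : Function.Bijective F := by
    constructor
    · intro x y hxy
      have hu : x.2 = y.2 := by
        refine Units.ext (Q.eq_of_form_eq hμ₀ fun a b => ?_)
        rw [← hform x.1, ← hform y.1, ← hF, ← hF, ← hF, ← hF, hxy]
      refine Prod.ext (Subtype.ext (mul_left_cancel (a := γ₀⁻¹) (gl_ext fun v => ?_))) hu
      rw [← glEquiv_apply, ← glEquiv_apply]
      have := congrArg (fun φ : Q.Trivialization => φ.1 ((ψ x.2).symm (φ₀.1.symm v))) hxy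
      simp only [hF] at this
      rw [← hu] at this
      simpa only [LinearEquiv.apply_symm_apply] using this
    · intro φ
      obtain ⟨μ, hμ, hφ⟩ := Q.exists_functional φ
      obtain ⟨u, hu⟩ := Q.exists_unit_mul_of_isGenerator hμ₀ hμ
      let g := (glEquiv _).symm ((φ₀.1.symm.trans (ψ u).symm).trans φ.1)
      have hg : g ∈ GSpMult (ZMod ℓ) 1 := by
        rw [mem_GSpMult_iff]
        intro v w
        rw [mulVec_glEquiv_symm, mulVec_glEquiv_symm]
        simp only [LinearEquiv.trans_apply]
        rw [hφ, hu, ← hψd, LinearEquiv.apply_symm_apply, LinearEquiv.apply_symm_apply, ← hφ₀,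
          LinearEquiv.apply_symm_apply, LinearEquiv.apply_symm_apply, one_mul]
      have hg' : γ₀ * g ∈ GSpMult (ZMod ℓ) Q.q := by
        simpa using mul_mem_GSpMult hγ₀ hg
      refine ⟨(⟨γ₀ * g, hg'⟩, u), Subtype.ext (LinearEquiv.ext fun a => ?_)⟩
      rw [hF, inv_mul_cancel_left, glEquiv_apply, mulVec_glEquiv_symm]
      simp
  rw [← Nat.card_congr (Equiv.ofBijective F hbij), Nat.card_prod, Nat.card_coe_set_eq]

/-- The `ℓ`-th power of a matrix has its eigenvalues moved by Frobenius, which fixes a polynomial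
over `𝔽_ℓ`. Thus `γ` and its semisimple part share their characteristic polynomial. -/
theorem charpoly_pow_pow (γ : GL (Fin 2 ⊕ Fin 2) (ZMod ℓ)) (M : ℕ) :
    (γ ^ ℓ ^ M).1.charpoly = γ.1.charpoly := by
  rw [Units.val_pow_eq_pow_val]
  induction M with
  | zero => simp
  | succ M ih => rw [pow_succ, pow_mul, ZMod.charpoly_pow_card, ih]

/-- A cyclic endomorphism with the characteristic polynomial of `T` makes `k⁴` a free `A`-module. -/
theorem exists_equiv_of_charpoly_eq (φ₀ : A ≃ₗ[ZMod ℓ] (Fin 2 ⊕ Fin 2 → ZMod ℓ))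
    {γ γ₀ : GL (Fin 2 ⊕ Fin 2) (ZMod ℓ)} (hφ₀ : ∀ a, γ₀.1.mulVec (φ₀ a) = φ₀ (Q.T * a))
    (hchar : γ.1.charpoly = γ₀.1.charpoly) {v : Fin 2 ⊕ Fin 2 → ZMod ℓ}
    (hv : Submodule.span (ZMod ℓ) (Set.range fun i : ℕ => (γ.1 ^ i).mulVec v) = ⊤) :
    ∃ φ : A ≃ₗ[ZMod ℓ] (Fin 2 ⊕ Fin 2 → ZMod ℓ), ∀ a, γ.1.mulVec (φ a) = φ (Q.T * a) := by
  have := Q.finite_A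
  have := Q.moduleFinite_A
  have hTint : IsIntegral (ZMod ℓ) Q.T := Algebra.IsIntegral.isIntegral _
  have haev : ∀ P : (ZMod ℓ)[X], φ₀ (aeval Q.T P) = (aeval γ₀.1 P).mulVec (φ₀ 1) := fun P => by
    induction P using Polynomial.induction_on' with
    | add P P' h h' => rw [map_add, map_add, map_add, Matrix.add_mulVec, h, h']
    | monomial n a =>
      rw [aeval_monomial, aeval_monomial, ← Algebra.smul_def, ← Algebra.smul_def, map_smul,
        Matrix.smul_mulVec, ← Units.val_pow_eq_pow_val,
        pow_mulVec hφ₀, mul_one]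
  let pb : PowerBasis (ZMod ℓ) A := PowerBasis.ofAdjoinEqTop hTint Q.adjoin_T_eq_top
  have hgen : pb.gen = Q.T := PowerBasis.ofAdjoinEqTop_gen hTint Q.adjoin_T_eq_top
  -- As `T` generates the four-dimensional `A`, its minimal polynomial is the characteristic
  -- polynomial. So `A` is `𝔽_ℓ[X]` modulo that polynomial and acts on `𝔽_ℓ⁴` through `γ`.
  have hmin : minpoly (ZMod ℓ) Q.T = γ₀.1.charpoly := by
    refine Eq.symm <| eq_of_monic_of_dvd_of_natDegree_le (minpoly.monic hTint)
      (Matrix.charpoly_monic _) (minpoly.dvd _ _ ?_) ?_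
    · apply φ₀.injective
      rw [haev, Matrix.aeval_self_charpoly, Matrix.zero_mulVec, map_zero]
    · rw [Matrix.charpoly_natDegree_eq_dim, ← hgen, pb.natDegree_minpoly, ← pb.finrank,
        Q.finrank_A]
      simp
  let ρ := pb.lift γ.1 (by rw [hgen, hmin, ← hchar, Matrix.aeval_self_charpoly])
  have hρT : ρ Q.T = γ.1 := by rw [← hgen]; exact pb.lift_gen _ _
  let φ : A →ₗ[ZMod ℓ] (Fin 2 ⊕ Fin 2 → ZMod ℓ) :=
    { toFun a := (ρ a).mulVec v
      map_add' a b := by rw [map_add, Matrix.add_mulVec]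
      map_smul' c a := by rw [map_smul, Matrix.smul_mulVec]; rfl }
  have hφ : ∀ a, φ a = (ρ a).mulVec v := fun _ => rfl
  have hsurj : Function.Surjective φ := by
    rw [← LinearMap.range_eq_top, eq_top_iff, ← hv, Submodule.span_le]
    rintro _ ⟨i, rfl⟩
    exact ⟨Q.T ^ i, by rw [hφ, map_pow, hρT]⟩
  have hinj : Function.Injective φ := (LinearMap.injective_iff_surjective_of_finrank_eq_finrank
    (by rw [Q.finrank_A]; simp)).2 hsurj
  refine ⟨LinearEquiv.ofBijective φ ⟨hinj, hsurj⟩, fun a => ?_⟩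
  change γ.1.mulVec (φ a) = φ (Q.T * a)
  rw [hφ, hφ, map_mul, hρT, Matrix.mulVec_mulVec]

/-- The cyclic similitudes whose semisimplification is conjugate to that of `T` are the similitudes
of multiplier `q` which make `k⁴` a free `A`-module of rank one. -/
theorem setOf_sameSemisimplification_eq (φ₀ : A ≃ₗ[ZMod ℓ] (Fin 2 ⊕ Fin 2 → ZMod ℓ))
    {γ₀ : GL (Fin 2 ⊕ Fin 2) (ZMod ℓ)} (hγ₀ : γ₀ ∈ GSpMult (ZMod ℓ) Q.q)
    (hφ₀ : ∀ a, γ₀.1.mulVec (φ₀ a) = φ₀ (Q.T * a)) {M : ℕ} (hM : 0 < M)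
    (hT : (Q.T ^ ℓ ^ M) ^ ℓ ^ M = Q.T ^ ℓ ^ M)
    (hss : ∀ γ s : GL (Fin 2 ⊕ Fin 2) (ZMod ℓ), IsSemisimplification γ s ↔ s = γ ^ ℓ ^ M) :
    {γ : GL (Fin 2 ⊕ Fin 2) (ZMod ℓ) |
      γ ∈ GSp (ZMod ℓ) ∧ IsCyclicElt γ ∧ SameSemisimplification γ γ₀} = Q.freeSimilitudes := by
  have := Q.finite_A
  have := Q.moduleFinite_A
  ext γ
  constructor
  · rintro ⟨⟨m, hγm⟩, ⟨v, hv⟩, s, t, hs, ht, h, ⟨n, hhn⟩, hst⟩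
    rw [hss] at hs ht
    subst hs ht
    -- Conjugate similitudes have equal multipliers, and taking `ℓ ^ M`-th powers is the identity on
    -- `𝔽_ℓ`.
    have hmq : (m : ZMod ℓ) = Q.q := by
      have h1 := mul_mem_GSpMult hhn (pow_mem_GSpMult hγm (ℓ ^ M))
      have h2 := mul_mem_GSpMult (pow_mem_GSpMult hγ₀ (ℓ ^ M)) hhn
      rw [mul_inv_eq_iff_eq_mul.1 hst] at h1
      have := GSpMult_unique h1 h2
      rw [ZMod.pow_card_pow, ZMod.pow_card_pow, mul_comm] at this
      exact mul_right_cancel₀ n.ne_zero this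
    have hchar : γ.1.charpoly = γ₀.1.charpoly := by
      rw [← charpoly_pow_pow γ M, ← charpoly_pow_pow γ₀ M, ← hst, Units.val_mul, Units.val_mul,
        Matrix.coe_units_inv, Matrix.charpoly_units_conj]
    exact ⟨hmq ▸ hγm, Q.exists_equiv_of_charpoly_eq φ₀ hφ₀ hchar hv⟩
  · rintro ⟨hγ, φ, hφ⟩
    refine ⟨⟨Units.mk0 Q.q Q.q_ne_zero, hγ⟩, ⟨φ 1, ?_⟩, ?_⟩
    · have hspan : (Submodule.span (ZMod ℓ) (Set.range fun i : ℕ => Q.T ^ i)) = ⊤ := by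
        have := congrArg Subalgebra.toSubmodule Q.adjoin_T_eq_top
        rw [Algebra.adjoin_eq_span, Algebra.top_toSubmodule] at this
        rw [← this]
        congr 1
        ext a
        exact Submonoid.mem_closure_singleton.symm
      have h1 : (Set.range fun i : ℕ => (γ.1 ^ i).mulVec (φ 1)) =
          φ.toLinearMap '' (Set.range fun i : ℕ => Q.T ^ i) := by
        rw [← Set.range_comp]
        congr 1
        ext1 i
        rw [← Units.val_pow_eq_pow_val]
        have := pow_mulVec hφ i 1
        rw [mul_one] at this
        exact this
      rw [h1, ← Submodule.map_span, hspan, Submodule.map_top, LinearEquiv.range]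
    -- The symplectic `g` need not conjugate `γ` to `γ₀`, since `ψ` commutes only with `T ^ ℓ ^ M`;
    -- that suffices for the semisimple parts.
    · obtain ⟨ψ, hψT, g, hg, hgφ⟩ := Q.exists_symplectic_comp hM hT
        ⟨φ, (Q.mul_mem_freeSimilitudes_iff hφ).1 hγ⟩
        ⟨φ₀, (Q.mul_mem_freeSimilitudes_iff hφ₀).1 hγ₀⟩
      refine ⟨γ ^ ℓ ^ M, γ₀ ^ ℓ ^ M, (hss _ _).2 rfl, (hss _ _).2 rfl, g, ⟨1, by simpa using hg⟩, ?_⟩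
      rw [mul_inv_eq_iff_eq_mul]
      refine gl_ext fun v => ?_
      obtain ⟨a, rfl⟩ := φ.surjective v
      simp only at hgφ
      rw [Units.val_mul, Units.val_mul, ← Matrix.mulVec_mulVec, ← Matrix.mulVec_mulVec, hgφ]
      have h1 := pow_mulVec hφ (ℓ ^ M) a
      have h2 := pow_mulVec hφ₀ (ℓ ^ M) (ψ a)
      rw [h1, h2, hgφ, hψT]

/-- Both sides count the trivializations. -/
theorem ncard_sameSemisimplification_mul (φ₀ : A ≃ₗ[ZMod ℓ] (Fin 2 ⊕ Fin 2 → ZMod ℓ))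
    {γ₀ : GL (Fin 2 ⊕ Fin 2) (ZMod ℓ)} (hγ₀ : γ₀ ∈ GSpMult (ZMod ℓ) Q.q)
    (hφ₀ : ∀ a, γ₀.1.mulVec (φ₀ a) = φ₀ (Q.T * a)) :
    {γ : GL (Fin 2 ⊕ Fin 2) (ZMod ℓ) |
      γ ∈ GSp (ZMod ℓ) ∧ IsCyclicElt γ ∧ SameSemisimplification γ γ₀}.ncard * Nat.card Aˣ =
    (GSpMult (ZMod ℓ) Q.q).ncard * Nat.card Rˣ := by
  obtain ⟨M, hM, hpow, hss⟩ := exists_isSemisimplification_iff ℓ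
  have hT : (Q.T ^ ℓ ^ M) ^ ℓ ^ M = Q.T ^ ℓ ^ M := by
    apply φ₀.injective
    have h1 := pow_mulVec hφ₀ (ℓ ^ M * ℓ ^ M) 1
    have h2 := pow_mulVec hφ₀ (ℓ ^ M) 1
    rw [pow_mul, hpow, h2, mul_one, mul_one, pow_mul] at h1
    exact h1.symm
  rw [Q.setOf_sameSemisimplification_eq φ₀ hγ₀ hφ₀ hM hT hss, ← Q.card_trivialization_eq,
    Q.card_trivialization_eq' hM hT ⟨φ₀, (Q.mul_mem_freeSimilitudes_iff hφ₀).1 hγ₀⟩ hγ₀]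

end PrimeField

end QuadTower

/-! ### Inertia and Frobenius in towers of Galois extensions -/

section Galois

open IsGaloisGroup

theorem natCard_int_quotient_under {S : Type*} [CommRing S] (P : Ideal S) (ℓ : ℕ)
    [P.LiesOver (Ideal.span {(ℓ : ℤ)})] : Nat.card (ℤ ⧸ P.under ℤ) = ℓ := by
  rw [← Ideal.over_def P (Ideal.span {(ℓ : ℤ)}), ← Submodule.cardQuot_apply,
    ← Ideal.absNorm_apply]
  simp

theorem natCard_quotient_of_liesOver {E : Type*} [Field E] [NumberField E] (P : Ideal (𝓞 E))
    [P.IsPrime] (ℓ : ℕ) [P.LiesOver (Ideal.span {(ℓ : ℤ)})] :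
    Nat.card (𝓞 E ⧸ P) = ℓ ^ P.inertiaDeg ℤ := by
  rw [Ideal.pow_inertiaDeg ℓ P, Ideal.absNorm_apply, Submodule.cardQuot_apply]

variable {ℓ : ℕ} [hℓ : Fact ℓ.Prime]

instance isPrime_span_natCast : (Ideal.span {(ℓ : ℤ)}).IsPrime := by
  rw [Ideal.span_singleton_prime (by exact_mod_cast hℓ.out.ne_zero)]
  exact Nat.prime_iff_prime_int.mp hℓ.out

theorem span_natCast_ne_bot : Ideal.span {(ℓ : ℤ)} ≠ ⊥ := by simpa using hℓ.out.ne_zero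

instance isMaximal_span_natCast : (Ideal.span {(ℓ : ℤ)}).IsMaximal :=
  isPrime_span_natCast.isMaximal span_natCast_ne_bot

variable {E : Type*} [Field E] [NumberField E]

theorem isMaximal_of_liesOver (P : Ideal (𝓞 E)) [P.IsPrime] [P.LiesOver (Ideal.span {(ℓ : ℤ)})] :
    P.IsMaximal :=
  Ideal.IsPrime.isMaximal inferInstance
    (Ideal.ne_bot_of_liesOver_of_ne_bot (p := Ideal.span {(ℓ : ℤ)}) span_natCast_ne_bot P)

theorem finite_quotient_of_liesOver (P : Ideal (𝓞 E)) [P.IsPrime]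
    [P.LiesOver (Ideal.span {(ℓ : ℤ)})] : Finite (𝓞 E ⧸ P) :=
  Ideal.finiteQuotientOfFreeOfNeBot P
    (Ideal.ne_bot_of_liesOver_of_ne_bot (p := Ideal.span {(ℓ : ℤ)}) span_natCast_ne_bot P)

/-- In a Galois extension the inertia group has order the ramification index, which is the same at
all primes above `ℓ`; one prime therefore decides. -/
theorem isUnramifiedIn_iff_inertia_eq_bot [IsGalois ℚ E] (P : Ideal (𝓞 E)) [P.IsPrime]
    [P.LiesOver (Ideal.span {(ℓ : ℤ)})] :
    IsUnramifiedIn E ℓ ↔ P.inertia (E ≃ₐ[ℚ] E) = ⊥ := by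
  rw [← Subgroup.card_eq_one, Ideal.card_inertia_eq_ramificationIdxIn (Ideal.span {(ℓ : ℤ)}) P,
    Ideal.ramificationIdxIn_eq_ramificationIdx (Ideal.span {(ℓ : ℤ)}) P (E ≃ₐ[ℚ] E)]
  refine ⟨fun h => Ideal.ramificationIdx_eq_one_iff.2 (h P inferInstance), fun h Q _ hQ => ?_⟩
  rw [← Ideal.ramificationIdx_eq_one_iff, ← h]
  exact Ideal.ramificationIdx_eq_of_isGaloisGroup (Ideal.span {(ℓ : ℤ)}) Q P (E ≃ₐ[ℚ] E)

/-- A power of a Frobenius at `P` is trivial modulo `P` if and only if the exponent is divisible by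
the inertia degree. -/
theorem pow_mem_inertia_iff {P : Ideal (𝓞 E)} [P.IsPrime] [P.LiesOver (Ideal.span {(ℓ : ℤ)})]
    {F : E ≃ₐ[ℚ] E} (hF : IsArithFrobAt ℤ F P) (n : ℕ) :
    F ^ n ∈ P.inertia (E ≃ₐ[ℚ] E) ↔ P.inertiaDeg ℤ ∣ n := by
  have := isMaximal_of_liesOver (ℓ := ℓ) P
  have := finite_quotient_of_liesOver (ℓ := ℓ) P
  let _ : Field (𝓞 E ⧸ P) := Ideal.Quotient.field P
  let _ : Field (ℤ ⧸ P.under ℤ) := Ideal.Quotient.field _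
  have hc := natCard_int_quotient_under P ℓ
  have : Finite (ℤ ⧸ P.under ℤ) := Nat.finite_of_card_ne_zero (by rw [hc]; exact hℓ.out.ne_zero)
  have : Fintype (ℤ ⧸ P.under ℤ) := Fintype.ofFinite _
  have hdeg : Module.finrank (ℤ ⧸ P.under ℤ) (𝓞 E ⧸ P) = P.inertiaDeg ℤ :=
    (Ideal.inertiaDeg_eq_of_isMaximal (P.under ℤ) P).symm
  rw [← hdeg, ← FiniteField.orderOf_frobeniusAlgHom, orderOf_dvd_iff_pow_eq_one]
  have hpow : ∀ x : 𝓞 E, Ideal.Quotient.mk P ((F ^ n) • x) =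
      Ideal.Quotient.mk P x ^ (ℓ ^ n) := fun x => by
    induction n with
    | zero => simp
    | succ n ih =>
      rw [pow_succ', mul_smul]
      have := hF.mk_apply ((F ^ n) • x)
      rw [hc] at this
      rw [pow_succ, pow_mul, ← ih, ← this]
      rfl
  have hfrob : ∀ y : 𝓞 E ⧸ P, (FiniteField.frobeniusAlgHom (ℤ ⧸ P.under ℤ) (𝓞 E ⧸ P) ^ n) y =
      y ^ (ℓ ^ n) := fun y => by
    rw [AlgHom.coe_pow, FiniteField.coe_frobeniusAlgHom, pow_iterate,
      ← Nat.card_eq_fintype_card, hc]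
  constructor
  · intro h
    ext y
    obtain ⟨x, rfl⟩ := Ideal.Quotient.mk_surjective y
    rw [hfrob, ← hpow, AlgHom.one_apply, Ideal.Quotient.eq]
    exact h x
  · intro h x
    change (F ^ n) • x - x ∈ P
    rw [← Ideal.Quotient.eq, hpow, ← hfrob, h, AlgHom.one_apply]

variable [IsGalois ℚ E] {K : Type*} [Field K] [NumberField K] [IsGalois ℚ K] [Algebra E K]

variable (E K) in
/-- Restriction of automorphisms of `K` to `E`. -/
abbrev resHom : (K ≃ₐ[ℚ] K) →* (E ≃ₐ[ℚ] E) :=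
  restrictHom (K ≃ₐ[ℚ] K) (E ≃ₐ[ℚ] E) ℤ (𝓞 E) (𝓞 K)

theorem algebraMap_resHom (σ : K ≃ₐ[ℚ] K) (x : E) :
    algebraMap E K (resHom E K σ x) = σ (algebraMap E K x) := by
  obtain ⟨a, b, hb, rfl⟩ := IsFractionRing.div_surjective (A := 𝓞 E) x
  have key : ∀ a : 𝓞 E, algebraMap E K (resHom E K σ (algebraMap (𝓞 E) E a)) =
      σ (algebraMap E K (algebraMap (𝓞 E) E a)) := fun a => by
    have h := congrArg (algebraMap (𝓞 K) K) (algebraMap_restrictHom_smul (K ≃ₐ[ℚ] K)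
      (E ≃ₐ[ℚ] E) ℤ (𝓞 E) (𝓞 K) σ a)
    exact h
  simp only [map_div₀, key]

theorem mem_ker_resHom_iff (σ : K ≃ₐ[ℚ] K) :
    σ ∈ (resHom E K).ker ↔ ∀ x : E, σ (algebraMap E K x) = algebraMap E K x := by
  rw [MonoidHom.mem_ker, AlgEquiv.ext_iff]
  refine forall_congr' fun x => ?_
  rw [← algebraMap_resHom, AlgEquiv.one_apply, (algebraMap E K).injective.eq_iff]

/-- One inclusion is clear and the other is a count. The order of inertia in `K/ℚ` is the product of
those in `E/ℚ` and `K/E`, and the kernel of restriction on the inertia group embeds in the inertia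
group of `K/E`. -/
theorem map_resHom_inertia (P : Ideal (𝓞 K)) [P.IsPrime] [P.LiesOver (Ideal.span {(ℓ : ℤ)})] :
    (P.inertia (K ≃ₐ[ℚ] K)).map (resHom E K) = (P.under (𝓞 E)).inertia (E ≃ₐ[ℚ] E) := by
  have : IsGalois E K := IsGalois.tower_top_of_isGalois ℚ E K
  set r := resHom E K
  have hle : (P.inertia (K ≃ₐ[ℚ] K)).map r ≤ (P.under (𝓞 E)).inertia (E ≃ₐ[ℚ] E) := by
    rintro _ ⟨σ, hσ, rfl⟩ x
    change algebraMap (𝓞 E) (𝓞 K) (r σ • x - x) ∈ P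
    rw [map_sub, algebraMap_restrictHom_smul]
    exact hσ _
  refine Subgroup.eq_of_le_of_card_ge hle ?_
  have hne : Nonempty ((P.under (𝓞 E)).primesOver (𝓞 K)) := ⟨P, inferInstance, inferInstance⟩
  have h1 := Ideal.card_inertia_eq_ramificationIdxIn (G := K ≃ₐ[ℚ] K) (Ideal.span {(ℓ : ℤ)}) P
  have h2 := Ideal.card_inertia_eq_ramificationIdxIn (G := E ≃ₐ[ℚ] E) (Ideal.span {(ℓ : ℤ)})
    (P.under (𝓞 E))
  have h3 := Ideal.card_inertia_eq_ramificationIdxIn (G := K ≃ₐ[E] K) (P.under (𝓞 E)) P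
  have h4 := Ideal.ramificationIdxIn_mul_ramificationIdxIn (p := Ideal.span {(ℓ : ℤ)})
    (P.under (𝓞 E)) (E ≃ₐ[ℚ] E) (𝓞 K) (K ≃ₐ[ℚ] K) (K ≃ₐ[E] K)
  rw [← h1, ← h2, ← h3] at h4
  let s := r.domRestrict (P.inertia (K ≃ₐ[ℚ] K))
  have h5 : Nat.card s.ker * Nat.card ((P.inertia (K ≃ₐ[ℚ] K)).map r) =
      Nat.card (P.inertia (K ≃ₐ[ℚ] K)) := by
    have : (P.inertia (K ≃ₐ[ℚ] K)).map r = s.range := by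
      rw [MonoidHom.domRestrict_range]
    rw [this, ← Subgroup.index_ker, Subgroup.card_mul_index]
  have h6 : Nat.card s.ker ≤ Nat.card (P.inertia (K ≃ₐ[E] K)) := by
    have hfix : ∀ σ : s.ker, ∀ x : E, σ.1.1 (algebraMap E K x) = algebraMap E K x := fun σ =>
      (mem_ker_resHom_iff _).1 (show r σ.1.1 = 1 from σ.2)
    let φ : s.ker → P.inertia (K ≃ₐ[E] K) := fun σ =>
      ⟨AlgEquiv.ofRingEquiv (f := σ.1.1.toRingEquiv) (hfix σ), fun x => σ.1.2 x⟩
    refine Nat.card_le_card_of_injective φ fun σ τ h => ?_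
    refine Subtype.ext (Subtype.ext (AlgEquiv.ext fun x => ?_))
    exact congrArg (fun g : P.inertia (K ≃ₐ[E] K) => g.1 x) h
  have h7 : 0 < Nat.card (P.inertia (K ≃ₐ[E] K)) := Nat.card_pos
  refine Nat.le_of_mul_le_mul_left ?_ h7
  rw [mul_comm, h4, ← h5]
  exact Nat.mul_le_mul_right _ h6

theorem isArithFrobAt_resHom {P : Ideal (𝓞 K)} {F : K ≃ₐ[ℚ] K} (hF : IsArithFrobAt ℤ F P) :
    IsArithFrobAt ℤ (resHom E K F) (P.under (𝓞 E)) := by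
  intro x
  have h : (P.under (𝓞 E)).under ℤ = P.under ℤ := Ideal.under_under P
  rw [h]
  change algebraMap (𝓞 E) (𝓞 K) (resHom E K F • x - x ^ _) ∈ P
  rw [map_sub, algebraMap_restrictHom_smul, map_pow]
  exact hF _

theorem resHom_surjective : Function.Surjective (resHom E K) :=
  restrictHom_surjective _ _ _ _ _

end Galois

/-! ### Products over characters of a finite abelian group -/

open Classical in
/-- The product of `1 - χ(F) x` over the characters `χ` of `G / N` is `(1 - x ^ f) ^ g`, where `f`
is the order of `F` in `G / N` and `f * g` is the order of `G / N`. -/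
theorem prod_characters_one_sub {G : Type*} [CommGroup G] [Finite G] [Fintype (G →* ℂˣ)]
    (N : Subgroup G) (F : G) {f g : ℕ} (hf : ∀ n : ℕ, F ^ n ∈ N ↔ f ∣ n) (hfg : f * g = N.index)
    (x : ℂ) :
    ∏ χ : G →* ℂˣ, (if N ≤ χ.ker then 1 - (χ F : ℂ) * x else 1) = (1 - x ^ f) ^ g := by
  have hf0 : f ≠ 0 := by
    rintro rfl
    exact N.index_ne_zero_of_finite (by rw [← hfg, zero_mul])
  have : NeZero f := ⟨hf0⟩
  let H : Subgroup (G →* ℂˣ) := (MonoidHom.domRestrictHom N ℂˣ).ker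
  have hH : ∀ χ, χ ∈ H ↔ N ≤ χ.ker := fun χ => by
    rw [MonoidHom.mem_ker, MonoidHom.domRestrictHom_apply, MonoidHom.domRestrict_eq_one_iff]
    rfl
  have hHcard : Nat.card H = f * g := by
    rw [hfg]
    exact CommGroup.card_domRestrictHom_ker ℂ N
  let ev : H →* ℂˣ := ((MonoidHom.eval F : (G →* ℂˣ) →* ℂˣ)).comp H.subtype
  have hev : ∀ χ : H, ev χ = χ.1 F := fun _ => rfl
  have hle : ev.range ≤ rootsOfUnity f ℂ := by
    rintro _ ⟨χ, rfl⟩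
    rw [mem_rootsOfUnity, hev, ← map_pow]
    exact (hH χ.1).1 χ.2 ((hf f).2 dvd_rfl)
  have hfinite : Finite (rootsOfUnity f ℂ) := inferInstanceAs (Finite (rootsOfUnity f ℂ))
  -- If the values at `F` form a group of order `d`, then every character trivial on `N` kills `F ^
  -- d`; so `F ^ d ∈ N` and `f ∣ d`.
  have hrange : ev.range = rootsOfUnity f ℂ := by
    refine Subgroup.eq_of_le_of_card_ge hle ?_
    rw [Complex.card_rootsOfUnity]
    refine Nat.le_of_dvd Nat.card_pos ((hf _).1 ?_)
    rw [← CommGroup.forall_monoidHom_apply_eq_one_iff ℂ]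
    intro χ hχ
    have h1 : (⟨ev ⟨χ, (hH χ).2 hχ⟩, ⟨_, rfl⟩⟩ : ev.range) ^ Nat.card ev.range = 1 :=
      pow_card_eq_one'
    have h2 := congrArg Subtype.val h1
    rw [map_pow]
    exact h2
  have hker : Nat.card ev.ker = g := by
    have h1 := Subgroup.card_mul_index ev.ker
    rw [Subgroup.index_ker, hrange, Complex.card_rootsOfUnity, hHcard, mul_comm] at h1
    exact Nat.eq_of_mul_eq_mul_left (Nat.pos_of_ne_zero hf0) h1
  rw [← Finset.prod_filter]
  have hmaps : ∀ χ ∈ Finset.univ.filter (fun χ : G →* ℂˣ => N ≤ χ.ker),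
      (χ F : ℂ) ∈ nthRootsFinset f (1 : ℂ) := fun χ hχ => by
    rw [Finset.mem_filter] at hχ
    rw [mem_nthRootsFinset (Nat.pos_of_ne_zero hf0)]
    have := hle ⟨⟨χ, (hH χ).2 hχ.2⟩, rfl⟩
    rw [mem_rootsOfUnity] at this
    rw [← Units.val_pow_eq_pow_val, show χ F ^ f = 1 from this, Units.val_one]
  -- Each `f`-th root of unity `ζ` is the value at `F` of exactly `g` characters, and the product of
  -- `1 - ζ x` over all `ζ` is `1 - x ^ f`.
  rw [← Finset.prod_fiberwise_of_maps_to hmaps]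
  have hζ := Complex.isPrimitiveRoot_exp f hf0
  have hprod := hζ.pow_sub_pow_eq_prod_sub_mul 1 x (Nat.pos_of_ne_zero hf0)
  rw [one_pow] at hprod
  rw [hprod, ← Finset.prod_pow]
  refine Finset.prod_congr rfl fun ζ hζ => ?_
  rw [Finset.prod_congr rfl (g := fun _ => 1 - ζ * x) (fun χ hχ => by
    rw [(Finset.mem_filter.1 hχ).2]), Finset.prod_const]
  congr 1
  rw [mem_nthRootsFinset (Nat.pos_of_ne_zero hf0)] at hζ
  obtain ⟨u, rfl⟩ : IsUnit ζ := IsUnit.of_pow_eq_one hζ hf0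
  have hu : u ∈ ev.range := by
    rw [hrange, mem_rootsOfUnity]
    exact Units.ext (by simpa using hζ)
  have hfib := MonoidHom.card_fiber_eq_of_mem_range ev (x := u) (y := 1) hu ⟨1, map_one _⟩
  have hker' : (Finset.univ.filter fun χ : H => ev χ = 1).card = g := by
    rw [← hker, Nat.card_eq_fintype_card, Fintype.card_subtype]
    simp only [MonoidHom.mem_ker]
  rw [← hker', ← hfib]
  refine (Finset.card_bij (fun χ _ => χ.1) ?_ ?_ ?_).symm
  · intro χ hχ
    rw [Finset.mem_filter] at hχ ⊢
    exact ⟨Finset.mem_filter.2 ⟨Finset.mem_univ _, (hH _).1 χ.2⟩, by rw [← hχ.2]; rfl⟩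
  · intro χ _ χ' _ h
    exact Subtype.ext h
  · intro χ hχ
    rw [Finset.mem_filter, Finset.mem_filter] at hχ
    exact ⟨⟨χ, (hH χ).2 hχ.1.2⟩, by simpa [hev] using Units.ext hχ.2, rfl⟩

/-! ### Units of finite quotients -/

/-- The number of units of a finite quotient `O / J`, in terms of the maximal ideals containing
`J`. -/
theorem natCard_units_quotient {O : Type*} [CommRing O] (J : Ideal O) [Finite (O ⧸ J)]
    {ι : Type*} [Fintype ι] (P : ι → Ideal O) (hmax : ∀ i, (P i).IsMaximal)
    (hinj : Function.Injective P) (hle : ∀ i, J ≤ P i)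
    (hall : ∀ m : Ideal O, m.IsMaximal → J ≤ m → ∃ i, P i = m) :
    (Nat.card (O ⧸ J)ˣ : ℚ) = Nat.card (O ⧸ J) * ∏ i, (1 - (Nat.card (O ⧸ P i) : ℚ)⁻¹) := by
  classical
  have hcop : Pairwise (Function.onFun IsCoprime P) := fun i j hij =>
    Ideal.isCoprime_of_isMaximal fun h => hij (hinj h)
  let π : (O ⧸ J) →+* (∀ i, O ⧸ P i) := RingHom.pi fun i => Ideal.Quotient.factor (hle i)
  have hπ : ∀ x i, π (Ideal.Quotient.mk J x) i = Ideal.Quotient.mk (P i) x := fun _ _ => rfl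
  have hsurj : Function.Surjective π := fun y => by
    obtain ⟨r, hr⟩ := Ideal.pi_quotient_surjective hcop y
    exact ⟨Ideal.Quotient.mk J r, funext fun i => by rw [hπ]; exact hr i⟩
  have hfinP : ∀ i, Finite (O ⧸ P i) := fun i =>
    Finite.of_surjective _ (Ideal.Quotient.factor_surjective (hle i))
  have := fun i => Fintype.ofFinite (O ⧸ P i)
  have := Fintype.ofFinite (O ⧸ J)
  have hunit : ∀ b, IsUnit b ↔ ∀ i, π b i ≠ 0 := fun b => by
    obtain ⟨x, rfl⟩ := Ideal.Quotient.mk_surjective b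
    constructor
    · intro hb i
      have := (hmax i).ne_top
      have : Nontrivial (O ⧸ P i) := Ideal.Quotient.nontrivial_iff.2 this
      exact ((hb.map π).map (Pi.evalRingHom (fun i => O ⧸ P i) i)).ne_zero
    · intro h
      by_contra hb
      obtain ⟨m, hm, hbm⟩ := exists_max_ideal_of_mem_nonunits hb
      obtain ⟨i, hi⟩ := hall (m.comap (Ideal.Quotient.mk J))
        (Ideal.comap_isMaximal_of_surjective _ Ideal.Quotient.mk_surjective) (by
          intro y hy
          rw [Ideal.mem_comap, Ideal.Quotient.eq_zero_iff_mem.2 hy]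
          exact m.zero_mem)
      refine h i ?_
      rw [hπ, Ideal.Quotient.eq_zero_iff_mem, hi]
      exact hbm
  let U : Finset (∀ i, O ⧸ P i) := Fintype.piFinset fun i => Finset.univ.filter (· ≠ 0)
  have hU : ∀ y, y ∈ U ↔ ∀ i, y i ≠ 0 := fun y => by simp [U]
  -- All fibres of the surjection onto the product of residue fields have the same size, and units
  -- are the elements with no zero component; the proportion of units is thus that of the product.
  obtain ⟨c, hc⟩ : ∃ c, ∀ y, (Finset.univ.filter fun b => π b = y).card = c :=
    ⟨_, fun y => AddMonoidHom.card_fiber_eq_of_mem_range π (hsurj y) (hsurj 0)⟩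
  have h1 : Nat.card (O ⧸ J) = Fintype.card (∀ i, O ⧸ P i) * c := by
    rw [Nat.card_eq_fintype_card, ← Finset.card_univ, Finset.card_eq_sum_card_fiberwise
      (f := π) (t := Finset.univ) (fun _ _ => Finset.mem_coe.2 (Finset.mem_univ _)),
      Finset.sum_congr rfl (fun y _ => hc y)]
    simp
  have h2 : Nat.card (O ⧸ J)ˣ = U.card * c := by
    have h3 : Nat.card (O ⧸ J)ˣ = (Finset.univ.filter fun b : O ⧸ J => IsUnit b).card := by
      rw [← Fintype.card_subtype, ← Nat.card_eq_fintype_card]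
      exact Nat.card_congr (Equiv.ofBijective (β := {b : O ⧸ J // IsUnit b})
        (fun u : (O ⧸ J)ˣ => ⟨u.1, u.isUnit⟩)
        ⟨fun u v h => Units.ext (congrArg Subtype.val h), fun b => ⟨b.2.unit, rfl⟩⟩)
    rw [h3, Finset.card_eq_sum_card_fiberwise (f := π) (t := U) (fun b hb => by
      rw [Finset.mem_coe, hU]
      exact (hunit b).1 (Finset.mem_filter.1 hb).2)]
    rw [Finset.sum_congr rfl (g := fun _ => c) (fun y hy => by
      rw [Finset.filter_filter, ← hc y]
      congr 1
      ext b
      simp only [Finset.mem_filter, Finset.mem_univ, true_and, and_iff_right_iff_imp]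
      rintro rfl
      exact (hunit b).2 ((hU _).1 hy)), Finset.sum_const, smul_eq_mul]
  have h4 : (U.card : ℚ) = ∏ i, ((Nat.card (O ⧸ P i) : ℚ) - 1) := by
    rw [Fintype.card_piFinset, Nat.cast_prod]
    refine Finset.prod_congr rfl fun i _ => ?_
    rw [Finset.filter_ne', Finset.card_erase_of_mem (Finset.mem_univ _), Finset.card_univ,
      Nat.cast_sub Fintype.card_pos, Nat.card_eq_fintype_card, Nat.cast_one]
  rw [h2, h1, Fintype.card_pi, Nat.cast_mul, Nat.cast_mul, h4, Nat.cast_prod, mul_right_comm,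
    ← Finset.prod_mul_distrib]
  congr 1
  refine Finset.prod_congr rfl fun i _ => ?_
  have : (Fintype.card (O ⧸ P i) : ℚ) ≠ 0 := by exact_mod_cast Fintype.card_ne_zero
  rw [Nat.card_eq_fintype_card, mul_sub, mul_one, mul_inv_cancel₀ this]

theorem natCard_quotient_span_natCast (ℓ : ℕ) (E : Type*) [Field E] [NumberField E] :
    Nat.card (𝓞 E ⧸ Ideal.span {(ℓ : 𝓞 E)}) = ℓ ^ Module.finrank ℚ E := by
  rw [← Submodule.cardQuot_apply, ← Ideal.absNorm_apply, Ideal.absNorm_span_natCast,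
    RingOfIntegers.rank]

/-! ### Units of `𝓞_E / ℓ` and values of characters -/

section Galois

variable {ℓ : ℕ} [hℓ : Fact ℓ.Prime]

theorem liesOver_span_natCast_iff {S : Type*} [CommRing S] (P : Ideal S) [P.IsPrime] :
    P.LiesOver (Ideal.span {(ℓ : ℤ)}) ↔ (ℓ : S) ∈ P := by
  constructor
  · intro h
    have : (ℓ : ℤ) ∈ P.under ℤ := by
      rw [← Ideal.over_def P (Ideal.span {(ℓ : ℤ)})]
      exact Ideal.mem_span_singleton_self _
    simpa using this
  · intro h
    refine ⟨isMaximal_span_natCast.eq_of_le (Ideal.IsPrime.under ℤ P).ne_top ?_⟩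
    rw [Ideal.span_le, Set.singleton_subset_iff]
    simpa [Ideal.mem_comap] using h

variable {E : Type*} [Field E] [NumberField E]

variable (E ℓ) in
theorem finite_quotient_span_natCast : Finite (𝓞 E ⧸ Ideal.span {(ℓ : 𝓞 E)}) :=
  Nat.finite_of_card_ne_zero (by
    rw [natCard_quotient_span_natCast]
    exact pow_ne_zero _ hℓ.out.ne_zero)

/-- The number of units of `𝓞_E / ℓ`, for a Galois extension `E / ℚ`. -/
theorem natCard_units_quotient_span_natCast [IsGalois ℚ E] (P : Ideal (𝓞 E)) [P.IsPrime]
    [P.LiesOver (Ideal.span {(ℓ : ℤ)})] :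
    (Nat.card (𝓞 E ⧸ Ideal.span {(ℓ : 𝓞 E)})ˣ : ℚ) = ℓ ^ Module.finrank ℚ E *
      (1 - (ℓ : ℚ)⁻¹ ^ P.inertiaDeg ℤ) ^ ((Ideal.span {(ℓ : ℤ)}).primesOver (𝓞 E)).ncard := by
  have := finite_quotient_span_natCast ℓ E
  have hfin : Finite ((Ideal.span {(ℓ : ℤ)}).primesOver (𝓞 E)) :=
    Algebra.QuasiFinite.finite_primesOver _
  have := Fintype.ofFinite ((Ideal.span {(ℓ : ℤ)}).primesOver (𝓞 E))
  have hinst : ∀ Q : (Ideal.span {(ℓ : ℤ)}).primesOver (𝓞 E),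
    Q.1.IsPrime ∧ Q.1.LiesOver (Ideal.span {(ℓ : ℤ)}) := fun Q => Q.2
  rw [natCard_units_quotient _ (fun Q : (Ideal.span {(ℓ : ℤ)}).primesOver (𝓞 E) => Q.1)
    (fun Q => by
      obtain ⟨_, _⟩ := hinst Q
      exact isMaximal_of_liesOver (ℓ := ℓ) Q.1) Subtype.val_injective
    (fun Q => by
      obtain ⟨_, h⟩ := hinst Q
      rw [Ideal.span_le, Set.singleton_subset_iff]
      exact (liesOver_span_natCast_iff _).1 h)
    (fun m hm hle => ⟨⟨m, hm.isPrime, (liesOver_span_natCast_iff m).2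
      (hle (Ideal.mem_span_singleton_self _))⟩, rfl⟩), natCard_quotient_span_natCast,
    Nat.cast_pow]
  congr 1
  rw [Finset.prod_congr rfl (g := fun _ => 1 - (ℓ : ℚ)⁻¹ ^ P.inertiaDeg ℤ) (fun Q _ => by
    obtain ⟨_, _⟩ := hinst Q
    rw [natCard_quotient_of_liesOver Q.1 ℓ, Nat.cast_pow, inv_pow,
      Ideal.inertiaDeg_eq_of_isGaloisGroup (Ideal.span {(ℓ : ℤ)}) Q.1 P (E ≃ₐ[ℚ] E)]),
    Finset.prod_const, Finset.card_univ, Set.fintypeCard_eq_ncard]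

variable {K : Type*} [Field K] [NumberField K] [IsGalois ℚ K]

open Classical in
/-- The value of a character at `ℓ` in terms of the inertia group and a Frobenius of `K`. -/
theorem charValue_eq (hcomm : ∀ σ τ : K ≃ₐ[ℚ] K, σ * τ = τ * σ) (χ : (K ≃ₐ[ℚ] K) →* ℂˣ)
    (P : Ideal (𝓞 K)) [P.IsPrime] [P.LiesOver (Ideal.span {(ℓ : ℤ)})] {F : K ≃ₐ[ℚ] K}
    (hF : IsArithFrobAt ℤ F P) :
    charValue χ ℓ = if P.inertia (K ≃ₐ[ℚ] K) ≤ χ.ker then (χ F : ℂ) else 0 := by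
  have : IsGalois ℚ (charField χ) := IsGalois.of_fixedField_normal_subgroup χ.ker
  have hker : (resHom (charField χ) K).ker = χ.ker := by
    ext σ
    rw [mem_ker_resHom_iff]
    conv_rhs => rw [← IntermediateField.fixingSubgroup_fixedField χ.ker]
    rw [IntermediateField.mem_fixingSubgroup_iff]
    exact ⟨fun h x hx => h ⟨x, hx⟩, fun h x => h x.1 x.2⟩
  have hP : IsUnramifiedIn (charField χ) ℓ ↔ P.inertia (K ≃ₐ[ℚ] K) ≤ χ.ker := by
    rw [isUnramifiedIn_iff_inertia_eq_bot (P.under (𝓞 (charField χ))),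
      ← map_resHom_inertia (ℓ := ℓ), Subgroup.map_eq_bot_iff, hker]
  rw [charValue]
  simp only [hP]
  split_ifs with h
  · obtain ⟨τ, hτ, Q, hQ, hQℓ, hτQ⟩ := (exists_restrictsToFrob χ ℓ).choose_spec
    set σ := (exists_restrictsToFrob χ ℓ).choose
    have hτσ : resHom (charField χ) K σ = τ := by
      ext x
      exact (algebraMap_resHom σ x).trans (hτ x).symm
    -- The prime `Q` is conjugate to the one below `P`. Conjugation does not change the Frobenius in
    -- an abelian group, and two Frobenius elements at `Q` differ by inertia, which is trivial here.
    obtain ⟨g, hg⟩ := Ideal.exists_smul_eq_of_isGaloisGroup (Ideal.span {(ℓ : ℤ)})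
      (P.under (𝓞 (charField χ))) Q (charField χ ≃ₐ[ℚ] charField χ)
    have h1 := (isArithFrobAt_resHom (E := charField χ) hF).conj g
    obtain ⟨g', rfl⟩ := resHom_surjective (E := charField χ) (K := K) g
    rw [hg, ← map_mul, ← map_inv, ← map_mul, hcomm g' F, mul_inv_cancel_right] at h1
    have h2 := hτQ.mul_inv_mem_inertia h1
    rw [(isUnramifiedIn_iff_inertia_eq_bot Q).1 (hP.2 h), Subgroup.mem_bot, ← hτσ, ← map_inv,
      ← map_mul, ← MonoidHom.mem_ker, hker, MonoidHom.mem_ker, map_mul, map_inv,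
      mul_inv_eq_one] at h2
    rw [h2]
  · rfl

end Galois

/-! ### Euler factors and units modulo `ℓ` -/

section EulerFactor

variable {ℓ : ℕ} [hℓ : Fact ℓ.Prime]
variable {K : Type*} [Field K] [NumberField K] [IsGalois ℚ K]

theorem finite_characters (G : Type*) [Group G] [Finite G] : Finite (G →* ℂˣ) := by
  have : NeZero (Nat.card G) := ⟨Nat.card_pos.ne'⟩
  have hfin : Finite (rootsOfUnity (Nat.card G) ℂ) :=
    inferInstanceAs (Finite (rootsOfUnity (Nat.card G) ℂ))
  refine Finite.of_injective (β := G → rootsOfUnity (Nat.card G) ℂ)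
    (fun χ g => ⟨χ g, by rw [mem_rootsOfUnity, ← map_pow, pow_card_eq_one', map_one]⟩)
    fun χ ψ h => MonoidHom.ext fun g => congrArg Subtype.val (congrFun h g)

open Classical in
/-- For abelian `K / ℚ`, the Euler factors at `ℓ` of the characters of `Gal(E/ℚ)` count the units
of `𝓞_E / ℓ`. -/
theorem prod_one_sub_charValue (hcomm : ∀ σ τ : K ≃ₐ[ℚ] K, σ * τ = τ * σ)
    [Fintype ((K ≃ₐ[ℚ] K) →* ℂˣ)]
    (E : Type*) [Field E] [NumberField E] [IsGalois ℚ E] [Algebra E K] :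
    ∏ χ : (K ≃ₐ[ℚ] K) →* ℂˣ,
      (if (resHom E K).ker ≤ χ.ker then 1 - charValue χ ℓ / (ℓ : ℂ) else 1) =
      (Nat.card (𝓞 E ⧸ Ideal.span {(ℓ : 𝓞 E)})ˣ : ℂ) / (ℓ : ℂ) ^ Module.finrank ℚ E := by
  obtain ⟨P, hP, hlies⟩ := Ideal.exists_maximal_ideal_liesOver_of_isIntegral (S := 𝓞 K)
    (Ideal.span {(ℓ : ℤ)})
  have := finite_quotient_of_liesOver (ℓ := ℓ) P
  obtain ⟨F, hF⟩ := IsArithFrobAt.exists_of_isInvariant ℤ (K ≃ₐ[ℚ] K) P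
  set r := resHom E K with hr
  -- A character is trivial on `N` exactly when it factors through `Gal(E/ℚ)` and is unramified at
  -- `ℓ`. Modulo `N`, the order of `F` is the residue degree in `E`, and the index of `N` is the
  -- degree times the number of primes.
  set N : Subgroup (K ≃ₐ[ℚ] K) := ((P.inertia (K ≃ₐ[ℚ] K)).map r).comap r with hN
  have hNle : ∀ χ : (K ≃ₐ[ℚ] K) →* ℂˣ,
      N ≤ χ.ker ↔ P.inertia (K ≃ₐ[ℚ] K) ≤ χ.ker ∧ r.ker ≤ χ.ker := fun χ => by
    rw [hN, Subgroup.comap_map_eq, sup_le_iff]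
  have hNmem : ∀ n : ℕ, F ^ n ∈ N ↔ (P.under (𝓞 E)).inertiaDeg ℤ ∣ n := fun n => by
    rw [hN, Subgroup.mem_comap, map_resHom_inertia (ℓ := ℓ), map_pow,
      pow_mem_inertia_iff (ℓ := ℓ) (isArithFrobAt_resHom hF)]
  have hNindex : (P.under (𝓞 E)).inertiaDeg ℤ *
      ((Ideal.span {(ℓ : ℤ)}).primesOver (𝓞 E)).ncard = N.index := by
    rw [hN, Subgroup.index_comap_of_surjective _ resHom_surjective, map_resHom_inertia (ℓ := ℓ)]
    have h1 := Ideal.ncard_primesOver_mul_card_inertia_mul_finrank (G := E ≃ₐ[ℚ] E)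
      (Ideal.span {(ℓ : ℤ)}) (P.under (𝓞 E))
    rw [← Subgroup.card_mul_index ((P.under (𝓞 E)).inertia (E ≃ₐ[ℚ] E))] at h1
    refine Nat.eq_of_mul_eq_mul_left
      (Nat.card_pos (α := (P.under (𝓞 E)).inertia (E ≃ₐ[ℚ] E))) (Eq.trans ?_ h1)
    ring
  have hnat := natCard_units_quotient_span_natCast (P.under (𝓞 E)) (ℓ := ℓ)
  have hℓ0 : (ℓ : ℂ) ≠ 0 := by exact_mod_cast hℓ.out.ne_zero
  have hnat' := congrArg (fun x : ℚ => (x : ℂ)) hnat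
  push_cast at hnat'
  rw [hnat', mul_div_cancel_left₀ _ (pow_ne_zero _ hℓ0)]
  let _ : CommGroup (K ≃ₐ[ℚ] K) := { (inferInstance : Group (K ≃ₐ[ℚ] K)) with mul_comm := hcomm }
  rw [← prod_characters_one_sub N F hNmem hNindex]
  refine Finset.prod_congr rfl fun χ _ => ?_
  rw [charValue_eq hcomm χ P hF]
  simp only [hNle]
  by_cases h1 : P.inertia (K ≃ₐ[ℚ] K) ≤ χ.ker <;> by_cases h2 : r.ker ≤ χ.ker <;>
    simp [h1, h2, div_eq_mul_inv]

theorem ker_resHom_self_le (χ : (K ≃ₐ[ℚ] K) →* ℂˣ) : (resHom K K).ker ≤ χ.ker := fun σ hσ => by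
  rw [mem_ker_resHom_iff] at hσ
  rw [show σ = 1 from AlgEquiv.ext hσ]
  exact one_mem _

/-- For `E = K` every character contributes its Euler factor to the product formula, whose
right-hand side is nonzero. -/
theorem one_sub_charValue_ne_zero (hcomm : ∀ σ τ : K ≃ₐ[ℚ] K, σ * τ = τ * σ)
    (χ : (K ≃ₐ[ℚ] K) →* ℂˣ) : 1 - charValue χ ℓ / (ℓ : ℂ) ≠ 0 := by
  have := finite_characters (K ≃ₐ[ℚ] K)
  have := Fintype.ofFinite ((K ≃ₐ[ℚ] K) →* ℂˣ)
  have h := prod_one_sub_charValue (ℓ := ℓ) hcomm K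
  have hℓ0 : (ℓ : ℂ) ≠ 0 := by exact_mod_cast hℓ.out.ne_zero
  have := finite_quotient_span_natCast ℓ K
  have hne : (Nat.card (𝓞 K ⧸ Ideal.span {(ℓ : 𝓞 K)})ˣ : ℂ) / (ℓ : ℂ) ^ Module.finrank ℚ K ≠ 0 :=
    div_ne_zero (by exact_mod_cast Nat.card_pos.ne') (pow_ne_zero _ hℓ0)
  rw [← h, Finset.prod_ne_zero_iff] at hne
  have h1 := hne χ (Finset.mem_univ _)
  rwa [if_pos (ker_resHom_self_le χ)] at h1

/-- `ν_ℓ(K)` in terms of the numbers of units modulo `ℓ` of `K` and of the subfield `E` cut out by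
the characters outside `S(K)`. -/
theorem nuK_eq (hcomm : ∀ σ τ : K ≃ₐ[ℚ] K, σ * τ = τ * σ)
    (E : Type*) [Field E] [NumberField E] [IsGalois ℚ E] [Algebra E K]
    (hE : ∀ χ : (K ≃ₐ[ℚ] K) →* ℂˣ, χ ∈ imagChars K ↔ ¬ (resHom E K).ker ≤ χ.ker) :
    nuK K ℓ = ((Nat.card (𝓞 E ⧸ Ideal.span {(ℓ : 𝓞 E)})ˣ : ℂ) / (ℓ : ℂ) ^ Module.finrank ℚ E) /
      ((Nat.card (𝓞 K ⧸ Ideal.span {(ℓ : 𝓞 K)})ˣ : ℂ) / (ℓ : ℂ) ^ Module.finrank ℚ K) := by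
  classical
  have := finite_characters (K ≃ₐ[ℚ] K)
  have := Fintype.ofFinite ((K ≃ₐ[ℚ] K) →* ℂˣ)
  rw [← prod_one_sub_charValue (ℓ := ℓ) hcomm E, ← prod_one_sub_charValue (ℓ := ℓ) hcomm K, nuK,
    finprod_mem_def, finprod_eq_prod_of_fintype, ← Finset.prod_div_distrib]
  refine Finset.prod_congr rfl fun χ _ => ?_
  rw [Set.mulIndicator_apply, if_pos (ker_resHom_self_le χ)]
  by_cases h : (resHom E K).ker ≤ χ.ker
  · rw [if_neg (by rw [hE]; exact not_not.2 h), if_pos h,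
      div_self (one_sub_charValue_ne_zero hcomm χ)]
  · rw [if_pos ((hE χ).2 h), if_neg h, one_div]

end EulerFactor

/-! ### Construction of quadratic towers and of symplectic bases -/

section Generators

variable {k A : Type*} [Field k] [CommRing A] [Algebra k A] {S T : A} {q c d : k}

theorem exists_eq_of_mem_adjoin (hS : S * S = c • S + d • 1) {r : A}
    (hr : r ∈ Algebra.adjoin k {S}) : ∃ a b : k, r = a • (1 : A) + b • S := by
  induction hr using Algebra.adjoin_induction with
  | mem x hx => exact ⟨0, 1, by rw [Set.mem_singleton_iff.1 hx]; simp⟩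
  | algebraMap a => exact ⟨a, 0, by simp [Algebra.algebraMap_eq_smul_one]⟩
  | add x y _ _ hx hy =>
    obtain ⟨a, b, rfl⟩ := hx
    obtain ⟨a', b', rfl⟩ := hy
    exact ⟨a + a', b + b', by module⟩
  | mul x y _ _ hx hy =>
    obtain ⟨a, b, rfl⟩ := hx
    obtain ⟨a', b', rfl⟩ := hy
    refine ⟨a * a' + b * b' * d, a * b' + b * a' + b * b' * c, ?_⟩
    have : (a • (1 : A) + b • S) * (a' • (1 : A) + b' • S) =
        (a * a') • (1 : A) + (a * b' + b * a') • S + (b * b') • (S * S) := by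
      simp only [Algebra.smul_def, map_mul, map_add]; ring
    rw [this, hS]
    module

theorem exists_eq_of_adjoin_eq_top (hT : T * T = S * T - algebraMap k A q)
    (htop : Algebra.adjoin k {S, T} = ⊤) (z : A) :
    ∃ x ∈ Algebra.adjoin k {S}, ∃ y ∈ Algebra.adjoin k {S}, z = x + y * T := by
  have hS : S ∈ Algebra.adjoin k {S} := Algebra.self_mem_adjoin_singleton k S
  have hz : z ∈ Algebra.adjoin k {S, T} := htop ▸ Algebra.mem_top
  induction hz using Algebra.adjoin_induction with
  | mem x hx =>
    rcases hx with rfl | rfl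
    · exact ⟨_, hS, 0, zero_mem _, by simp⟩
    · exact ⟨0, zero_mem _, 1, one_mem _, by simp⟩
  | algebraMap a => exact ⟨_, algebraMap_mem _ a, 0, zero_mem _, by simp⟩
  | add z z' _ _ h h' =>
    obtain ⟨x, hx, y, hy, rfl⟩ := h
    obtain ⟨x', hx', y', hy', rfl⟩ := h'
    exact ⟨x + x', add_mem hx hx', y + y', add_mem hy hy', by ring⟩
  | mul z z' _ _ h h' =>
    obtain ⟨x, hx, y, hy, rfl⟩ := h
    obtain ⟨x', hx', y', hy', rfl⟩ := h'
    refine ⟨x * x' - y * y' * algebraMap k A q,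
      sub_mem (mul_mem hx hx') (mul_mem (mul_mem hy hy') (algebraMap_mem _ q)),
      x * y' + y * x' + y * y' * S,
      add_mem (add_mem (mul_mem hx hy') (mul_mem hy hx')) (mul_mem (mul_mem hy hy') hS), ?_⟩
    linear_combination y * y' * hT

/-- A four-dimensional algebra generated by `S` and `T` with `S` quadratic and `T² - S T + q = 0`
is a quadratic tower over `k[S]`. -/
theorem exists_quadTower (hq : q ≠ 0) (hS : S * S = c • S + d • 1)
    (hT : T * T = S * T - algebraMap k A q) (htop : Algebra.adjoin k {S, T} = ⊤)
    (hrank : Module.finrank k A = 4) :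
    ∃ Q : QuadTower k (Algebra.adjoin k {S}) A, Q.s = S ∧ Q.T = T ∧ Q.q = q := by
  have hspan : ⊤ ≤ Submodule.span k (Set.range ![1, S, T, S * T]) := fun z _ => by
    obtain ⟨x, hx, y, hy, rfl⟩ := exists_eq_of_adjoin_eq_top hT htop z
    obtain ⟨a, b, rfl⟩ := exists_eq_of_mem_adjoin hS hx
    obtain ⟨a', b', rfl⟩ := exists_eq_of_mem_adjoin hS hy
    have : a • (1 : A) + b • S + (a' • 1 + b' • S) * T =
        ∑ i, ![a, b, a', b'] i • ![1, S, T, S * T] i := by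
      simp [Fin.sum_univ_four, add_mul, add_assoc]
    rw [this]
    exact sum_mem fun i _ => Submodule.smul_mem _ _ (Submodule.subset_span ⟨i, rfl⟩)
  -- Four spanning vectors in dimension four are independent; the bases of `R` over `k` and of `A`
  -- over `R` both follow.
  have hli := linearIndependent_of_top_le_span_of_card_eq_finrank hspan (by simp [hrank])
  have hzero : ∀ a b a' b' : k, a • (1 : A) + b • S + (a' • 1 + b' • S) * T = 0 →
      a = 0 ∧ b = 0 ∧ a' = 0 ∧ b' = 0 := fun a b a' b' h => by
    have h1 := Fintype.linearIndependent_iff.1 hli ![a, b, a', b'] (by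
      rw [← h]; simp [Fin.sum_univ_four, add_mul, add_assoc])
    exact ⟨h1 0, h1 1, h1 2, h1 3⟩
  let R := Algebra.adjoin k {S}
  let σ : R := ⟨S, Algebra.self_mem_adjoin_singleton k S⟩
  have hliR : LinearIndependent k ![(1 : R), σ] := by
    rw [LinearIndependent.pair_iff]
    intro a b h
    have h1 := hzero a b 0 0 (by simpa using congrArg Subtype.val h)
    exact ⟨h1.1, h1.2.1⟩
  have hspanR : ⊤ ≤ Submodule.span k (Set.range ![(1 : R), σ]) := fun r _ => by
    obtain ⟨a, b, h⟩ := exists_eq_of_mem_adjoin hS r.2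
    rw [show r = a • (1 : R) + b • σ from Subtype.ext h]
    exact add_mem (Submodule.smul_mem _ _ (Submodule.subset_span ⟨0, rfl⟩))
      (Submodule.smul_mem _ _ (Submodule.subset_span ⟨1, rfl⟩))
  have hliA : LinearIndependent R ![(1 : A), T] := by
    rw [LinearIndependent.pair_iff]
    intro x y h
    obtain ⟨a, b, hx⟩ := exists_eq_of_mem_adjoin hS x.2
    obtain ⟨a', b', hy⟩ := exists_eq_of_mem_adjoin hS y.2
    have h' : (x : A) + y * T = 0 := by simpa [Subalgebra.smul_def] using h
    rw [hx, hy] at h'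
    obtain ⟨rfl, rfl, rfl, rfl⟩ := hzero a b a' b' h'
    exact ⟨Subtype.ext (by rw [hx]; simp), Subtype.ext (by rw [hy]; simp)⟩
  have hspanA : ⊤ ≤ Submodule.span R (Set.range ![(1 : A), T]) := fun z _ => by
    obtain ⟨x, hx, y, hy, h⟩ := exists_eq_of_adjoin_eq_top hT htop z
    rw [show z = (⟨x, hx⟩ : R) • (1 : A) + (⟨y, hy⟩ : R) • T by
      simpa [Subalgebra.smul_def] using h]
    exact add_mem (Submodule.smul_mem _ _ (Submodule.subset_span ⟨0, rfl⟩))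
      (Submodule.smul_mem _ _ (Submodule.subset_span ⟨1, rfl⟩))
  exact ⟨⟨σ, T, q, hq, Module.Basis.mk hliR hspanR, Module.Basis.mk hliA hspanA, by simp, by simp,
    by simp, by simp, hT⟩, rfl, rfl, rfl⟩

end Generators

namespace QuadTower

variable {k R A : Type*} [Field k] [CommRing R] [CommRing A] [Algebra k R]
    [Algebra k A] [Algebra R A] [IsScalarTower k R A] (Q : QuadTower k R A)

theorem form_T_mul_left (μ : R →ₗ[k] k) (a b : A) :
    Q.form μ (Q.T * a) b = Q.form μ a (Q.Tbar * b) :=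
  Q.apply_T_mul (Q.form_T_mul μ) a b

theorem form_Tbar_mul_left (μ : R →ₗ[k] k) (a b : A) :
    Q.form μ (Q.Tbar * a) b = Q.form μ a (Q.T * b) := by
  rw [← (Q.form_isAlt μ).neg_eq, ← form_T_mul_left, (Q.form_isAlt μ).neg_eq]

/-- The forms attached to generators of the dual of `R` have symplectic bases. -/
theorem exists_symplectic_basis {μ : R →ₗ[k] k} (h : IsGenerator μ) :
    ∃ b : Module.Basis (Fin 2 ⊕ Fin 2) k A, ∀ i j, Q.form μ (b i) (b j) = J k i j := by
  -- The `d j` form the basis of `R` dual to `1, s` under `μ`. As `det(x, y T) = x y`, the vectors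
  -- `basisR i` and `d j T` pair to `1` or `0`, while `R` and `R T` are isotropic.
  choose d hd using fun j => Q.exists_mul_of_isGenerator h (Q.basisR.coord j)
  let v : Fin 2 ⊕ Fin 2 → A :=
    Sum.elim (fun i => Q.basisR i • (1 : A)) fun j => d j • Q.T
  have hv : ∀ i j, Q.form μ (v i) (v j) = J k i j := by
    rintro (i | i) (j | j)
    · simp [v, detForm, J]
    · simp [v, detForm, J, mul_comm _ (d j), ← hd, Finsupp.single_apply, Matrix.one_apply]
    · simp [v, detForm, J, mul_comm _ (d i), ← hd, Finsupp.single_apply, Matrix.one_apply, eq_comm]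
    · simp [v, detForm, J]
  have hli : LinearIndependent k v := by
    rw [Fintype.linearIndependent_iff]
    intro g hg
    have h1 : ∀ j, ∑ i, g i * J k i j = 0 := fun j => by
      have := congrArg (fun a => Q.form μ a (v j)) hg
      simpa only [map_sum, map_smul, LinearMap.sum_apply, LinearMap.smul_apply, smul_eq_mul, hv,
        map_zero, LinearMap.zero_apply] using this
    rintro (i | i)
    · simpa [J, Matrix.one_apply] using h1 (.inr i)
    · simpa [J, Matrix.one_apply] using h1 (.inl i)
  refine ⟨basisOfLinearIndependentOfCardEqFinrank hli (by simp [Q.finrank_A]), fun i j => ?_⟩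
  rw [coe_basisOfLinearIndependentOfCardEqFinrank, hv]

end QuadTower

/-! ### The field of a Weil quartic -/

section WeilField

variable {p q : ℕ} {f : ℤ[X]} {K : Type*} [Field K] [NumberField K] {ϖ : K}

/-- The quartic is the product of the `X² - (αⱼ + βⱼ) X + q`, so the sums `αⱼ + βⱼ` are the roots of
`Y² + a₃ Y + (a₂ - 2q)`. Since `|z|² = q`, the partner of a root `z ≠ 0` is its complex conjugate.
-/
theorem IsWeilQuartic.mul_conj_eq (hf : IsWeilQuartic q f) {z : ℂ} (hz : aeval z f = 0) :
    z * starRingEnd ℂ z = q ∧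
      (z + starRingEnd ℂ z) ^ 2 + f.coeff 3 * (z + starRingEnd ℂ z) + (f.coeff 2 - 2 * q) = 0 := by
  obtain ⟨-, -, α, β, hfac, hmul, hnorm⟩ := hf
  have hexp : f.map (Int.castRingHom ℂ) = X ^ 4 + C (-(α 0 + β 0) - (α 1 + β 1)) * X ^ 3 +
      C ((α 0 + β 0) * (α 1 + β 1) + α 0 * β 0 + α 1 * β 1) * X ^ 2 +
      C (-(α 0 * β 0 * (α 1 + β 1)) - α 1 * β 1 * (α 0 + β 0)) * X +
      C (α 0 * β 0 * (α 1 * β 1)) := by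
    rw [hfac, Fin.prod_univ_two]
    simp only [C_add, C_mul, C_sub, C_neg]
    ring
  have hcoeff : ∀ a b c d : ℂ,
      (X ^ 4 + C a * X ^ 3 + C b * X ^ 2 + C c * X + C d : ℂ[X]).coeff 3 = a ∧
      (X ^ 4 + C a * X ^ 3 + C b * X ^ 2 + C c * X + C d : ℂ[X]).coeff 2 = b := fun a b c d => by
    simp [coeff_X_pow]
  have h3 : (f.coeff 3 : ℂ) = -(α 0 + β 0) - (α 1 + β 1) := by
    exact (coeff_map _ _).symm.trans ((congrArg (fun g => g.coeff 3) hexp).trans (hcoeff _ _ _ _).1)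
  have h2 : (f.coeff 2 : ℂ) = (α 0 + β 0) * (α 1 + β 1) + α 0 * β 0 + α 1 * β 1 := by
    exact (coeff_map _ _).symm.trans ((congrArg (fun g => g.coeff 2) hexp).trans (hcoeff _ _ _ _).2)
  rw [aeval_def, eval₂_eq_eval_map, show algebraMap ℤ ℂ = Int.castRingHom ℂ from rfl, hfac,
    Fin.prod_univ_two] at hz
  simp only [eval_mul, eval_sub, eval_X, eval_C, mul_eq_zero, sub_eq_zero] at hz
  have hnz : ‖z‖ = √(q : ℝ) := by
    rcases hz with (rfl | rfl) | (rfl | rfl)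
    exacts [(hnorm 0).1, (hnorm 0).2, (hnorm 1).1, (hnorm 1).2]
  have hzz : z * starRingEnd ℂ z = q := by
    rw [Complex.mul_conj, Complex.normSq_eq_norm_sq, hnz, Real.sq_sqrt (Nat.cast_nonneg q)]
    simp
  refine ⟨hzz, ?_⟩
  have hcancel : ∀ a b c : ℂ, a * b = q → a * c = q → a ≠ 0 → b = c := fun a b c hb hc ha =>
    mul_left_cancel₀ ha (hb.trans hc.symm)
  by_cases hz0 : z = 0
  · have hq0 : (q : ℂ) = 0 := by rw [← hzz, hz0, zero_mul]
    have hq0' : q = 0 := by exact_mod_cast hq0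
    have hα : ∀ j, α j = 0 := fun j => by
      rw [← norm_eq_zero, (hnorm j).1, hq0']; simp
    have hβ : ∀ j, β j = 0 := fun j => by
      rw [← norm_eq_zero, (hnorm j).2, hq0']; simp
    simp [h2, h3, hα, hβ, hz0, hq0']
  rw [h2, h3, hmul, hmul]
  rcases hz with (rfl | rfl) | (rfl | rfl)
  · rw [← hcancel _ _ _ (hmul 0) hzz hz0]; ring
  · rw [← hcancel _ _ _ ((mul_comm _ _).trans (hmul 0)) hzz hz0]; ring
  · rw [← hcancel _ _ _ (hmul 1) hzz hz0]; ring
  · rw [← hcancel _ _ _ ((mul_comm _ _).trans (hmul 1)) hzz hz0]; ring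

theorem aeval_ringHom_apply {K L : Type*} [Field K] [Field L] (φ : K →+* L) (x : K) (f : ℤ[X]) :
    aeval (φ x) f = φ (aeval x f) :=
  aeval_algHom_apply φ.toIntAlgHom x f

namespace IsAdmissible

variable (hf : IsAdmissible p q f K ϖ)
include hf

theorem minpoly_eq : minpoly ℚ ϖ = f.map (Int.castRingHom ℚ) := by
  refine (minpoly.eq_of_irreducible_of_monic hf.irreducible ?_ (hf.weil.1.map _)).symm
  rw [← hf.rootField.1]
  exact aeval_map_algebraMap ℚ ϖ f

theorem finrank_eq : Module.finrank ℚ K = 4 := by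
  have h := IntermediateField.adjoin.finrank (K := ℚ) (x := ϖ) (Algebra.IsIntegral.isIntegral ϖ)
  rw [hf.rootField.2, IntermediateField.finrank_top', hf.minpoly_eq, hf.weil.1.natDegree_map,
    hf.weil.2.1] at h
  exact h

theorem algHom_ext {L : Type*} [Field L] [Algebra ℚ L] {φ ψ : K →ₐ[ℚ] L} (h : φ ϖ = ψ ϖ) :
    φ = ψ := by
  have htop := hf.rootField.2
  ext x
  have hx : x ∈ IntermediateField.adjoin ℚ {ϖ} := htop ▸ IntermediateField.mem_top
  induction hx using IntermediateField.adjoin_induction with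
  | mem x hx => rwa [Set.mem_singleton_iff.1 hx]
  | algebraMap x => simp
  | add x y _ _ hx hy => simp [hx, hy]
  | inv x _ hx => simp [hx]
  | mul x y _ _ hx hy => simp [hx, hy]

variable (hp : p.Prime)
include hp

theorem q_ne_zero : q ≠ 0 := by
  obtain ⟨e, -, rfl⟩ := hf.primePow
  exact pow_ne_zero _ hp.ne_zero

theorem natCast_ne_zero {ℓ : ℕ} [hℓ : Fact ℓ.Prime] (h : ℓ ≠ p) : (q : ZMod ℓ) ≠ 0 := by
  obtain ⟨e, -, rfl⟩ := hf.primePow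
  rw [Ne, ZMod.natCast_eq_zero_iff]
  intro hdvd
  exact h ((Nat.prime_dvd_prime_iff_eq hℓ.out hp).1 (hℓ.out.dvd_of_dvd_pow hdvd))

theorem ne_zero : ϖ ≠ 0 := by
  rintro rfl
  obtain ⟨φ⟩ : Nonempty (K →+* ℂ) := inferInstance
  have h := (hf.weil.mul_conj_eq (z := φ 0) (by
    rw [aeval_ringHom_apply, hf.rootField.1, map_zero])).1
  rw [map_zero, zero_mul] at h
  exact hf.q_ne_zero hp (by exact_mod_cast h.symm)

/-- Otherwise `ϖ² = q`, against degree four. This is what makes complex conjugation nontrivial on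
`K`. -/
theorem ne_natCast_div : ϖ ≠ q / ϖ := fun h => by
  have hsq : ϖ ^ 2 = q := by
    rw [sq]
    nth_rw 1 [h]
    exact div_mul_cancel₀ _ (hf.ne_zero hp)
  have hle := natDegree_le_natDegree (minpoly.min ℚ ϖ (monic_X_pow_sub_C (q : ℚ) two_ne_zero)
    (by simp [hsq]))
  rw [natDegree_X_pow_sub_C, hf.minpoly_eq, hf.weil.1.natDegree_map, hf.weil.2.1] at hle
  omega

/-- The intrinsic complex conjugation of the field of a Weil quartic. -/
theorem exists_conj [IsGalois ℚ K] : ∃ ι : K ≃ₐ[ℚ] K,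
    (∀ φ : K →+* ℂ, ComplexEmbedding.IsConj φ ι) ∧ ϖ * ι ϖ = q ∧ ι ≠ 1 ∧
    (ϖ + ι ϖ) ^ 2 + f.coeff 3 * (ϖ + ι ϖ) + (f.coeff 2 - 2 * q) = 0 := by
  have hroot : ∀ φ : K →+* ℂ, aeval (φ ϖ) f = 0 := fun φ => by
    rw [aeval_ringHom_apply, hf.rootField.1, map_zero]
  have hϖ := hf.ne_zero hp
  have hconj : ∀ φ : K →+* ℂ, φ (q / ϖ) = starRingEnd ℂ (φ ϖ) := fun φ => by
    rw [map_div₀, map_natCast, ← (hf.weil.mul_conj_eq (hroot φ)).1,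
      mul_div_cancel_left₀ _ ((map_ne_zero φ).2 hϖ)]
  obtain ⟨φ₀⟩ : Nonempty (K →+* ℂ) := inferInstance
  -- Every embedding sends `q / ϖ` to the complex conjugate of the image of `ϖ`, again a root of
  -- `f`; as `K` is Galois, some automorphism carries `ϖ` to `q / ϖ`.
  have hroot' : aeval (q / ϖ : K) (minpoly ℚ ϖ) = 0 := by
    rw [hf.minpoly_eq]
    refine (aeval_map_algebraMap ℚ (q / ϖ : K) f).trans (φ₀.injective ?_)
    rw [← aeval_ringHom_apply, hconj, aeval_ringHom_apply, hroot, map_zero, map_zero]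
  obtain ⟨ι, hι⟩ := minpoly.exists_algEquiv_of_root' (Algebra.IsAlgebraic.isAlgebraic _) hroot'
  refine ⟨ι, fun φ => ?_, by rw [hι, mul_div_cancel₀ _ hϖ], ?_, φ₀.injective ?_⟩
  · have h := hf.algHom_ext (φ := (ComplexEmbedding.conjugate φ).toRatAlgHom)
      (ψ := (φ.comp (ι : K →+* K)).toRatAlgHom) (by
        change starRingEnd ℂ (φ ϖ) = φ (ι ϖ)
        rw [hι, hconj])
    exact congrArg (fun ψ : K →ₐ[ℚ] ℂ => (ψ : K →+* ℂ)) h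
  · rintro rfl
    exact hf.ne_natCast_div hp hι
  · have h := (hf.weil.mul_conj_eq (hroot φ₀)).2
    rw [← hconj, ← hι] at h
    simpa [map_ofNat] using h

end IsAdmissible

end WeilField

namespace IsAdmissible

variable {p q : ℕ} {f : ℤ[X]} {K : Type*} [Field K] [NumberField K] {ϖ : K}
  (hf : IsAdmissible p q f K ϖ)
include hf

/-- A group of order `2²` is abelian. -/
theorem gal_comm [IsGalois ℚ K] (σ τ : K ≃ₐ[ℚ] K) : σ * τ = τ * σ := by
  have : Fact (Nat.Prime 2) := ⟨Nat.prime_two⟩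
  have h : Nat.card (K ≃ₐ[ℚ] K) = 2 ^ 2 := by
    rw [IsGalois.card_aut_eq_finrank, hf.finrank_eq]; norm_num
  exact (IsPGroup.isMulCommutative_of_card_eq_prime_sq h).is_comm.comm σ τ

/-- The ring of integers is generated by a lift of `ϖ` and its conjugate. -/
theorem exists_adjoin_eq_top {ι : K ≃ₐ[ℚ] K}
    (hι : ∀ φ : K →+* ℂ, ComplexEmbedding.IsConj φ ι) :
    ∃ w : 𝓞 K, (w : K) = ϖ ∧ Algebra.adjoin ℤ {w, ι • w} = ⊤ := by
  obtain ⟨φ⟩ : Nonempty (K →+* ℂ) := inferInstance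
  have hadj : Algebra.adjoin ℤ {ϖ, ι ϖ} = integralClosure ℤ K := by
    refine Subalgebra.map_injective (f := φ.toIntAlgHom) φ.injective ?_
    rw [← hf.maximal φ, AlgHom.map_adjoin, Set.image_pair]
    congr 2
    exact congrArg (fun z => ({z} : Set ℂ)) ((hι φ).eq ϖ)
  have hw : ϖ ∈ integralClosure ℤ K := hadj ▸ Algebra.subset_adjoin (Set.mem_insert _ _)
  let w : 𝓞 K := ⟨ϖ, hw⟩
  refine ⟨w, rfl, ?_⟩
  refine Subalgebra.map_injective (f := (algebraMap (𝓞 K) K).toIntAlgHom)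
    RingOfIntegers.coe_injective ?_
  rw [AlgHom.map_adjoin, Set.image_pair, Algebra.map_top]
  refine hadj.trans (Subalgebra.ext fun x => ⟨fun hx => ⟨⟨x, hx⟩, rfl⟩, ?_⟩)
  rintro ⟨y, rfl⟩
  exact y.2

end IsAdmissible

/-! ### Reduction modulo `ℓ` of the ring of integers -/

section Reduction

variable (K : Type*) [Field K] (ℓ : ℕ) [hℓ : Fact ℓ.Prime]

/-- The reduction map `𝓞_K → κ(ℓ)`. -/
def reduction : 𝓞 K →+* Kappa K ℓ := (Algebra.TensorProduct.includeRight : 𝓞 K →ₐ[ℤ] Kappa K ℓ)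

variable {K} in
theorem reduction_apply (a : 𝓞 K) : reduction K ℓ a = 1 ⊗ₜ a := rfl

theorem reduction_surjective : Function.Surjective (reduction K ℓ) := fun z => by
  induction z using TensorProduct.induction_on with
  | zero => exact ⟨0, map_zero _⟩
  | tmul c a =>
    refine ⟨(c.val : ℤ) • a, ?_⟩
    rw [reduction_apply, TensorProduct.tmul_smul, TensorProduct.smul_tmul']
    simp
  | add x y hx hy =>
    obtain ⟨a, rfl⟩ := hx
    obtain ⟨b, rfl⟩ := hy
    exact ⟨a + b, map_add _ _ _⟩

variable [NumberField K]

theorem finrank_kappa : Module.finrank (ZMod ℓ) (Kappa K ℓ) = Module.finrank ℚ K := by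
  rw [Module.finrank_baseChange, RingOfIntegers.rank]

theorem finite_kappa : Finite (Kappa K ℓ) := Module.finite_of_finite (ZMod ℓ)

theorem natCard_kappa : Nat.card (Kappa K ℓ) = ℓ ^ Module.finrank ℚ K := by
  rw [Module.natCard_eq_pow_finrank (K := ZMod ℓ), finrank_kappa, Nat.card_zmod]

/-- The kernel contains `ℓ`, and `𝓞 K / ℓ` and `κ(ℓ)` both have `ℓ ^ [K:ℚ]` elements. -/
theorem ker_reduction : RingHom.ker (reduction K ℓ) = Ideal.span {(ℓ : 𝓞 K)} := by
  have hle : Ideal.span {(ℓ : 𝓞 K)} ≤ RingHom.ker (reduction K ℓ) := by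
    rw [Ideal.span_le, Set.singleton_subset_iff, SetLike.mem_coe, RingHom.mem_ker, map_natCast,
      ← map_natCast (algebraMap (ZMod ℓ) (Kappa K ℓ)), ZMod.natCast_self, map_zero]
  refine le_antisymm (fun x hx => ?_) hle
  have := finite_quotient_span_natCast ℓ K
  have := finite_kappa K ℓ
  let π : 𝓞 K ⧸ Ideal.span {(ℓ : 𝓞 K)} →+* Kappa K ℓ := Ideal.Quotient.lift _ (reduction K ℓ) hle
  have hπ : Function.Surjective π := Ideal.Quotient.lift_surjective_of_surjective _ _
    (reduction_surjective K ℓ)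
  have hinj := (hπ.bijective_of_nat_card_le (by
    rw [natCard_kappa, natCard_quotient_span_natCast])).injective
  rw [← Ideal.Quotient.eq_zero_iff_mem]
  exact hinj (by rw [map_zero]; exact hx)

theorem natCard_units_kappa :
    Nat.card (Kappa K ℓ)ˣ = Nat.card (𝓞 K ⧸ Ideal.span {(ℓ : 𝓞 K)})ˣ := by
  rw [← ker_reduction]
  exact Nat.card_congr (Units.mapEquiv
    (RingHom.quotientKerEquivOfSurjective (reduction_surjective K ℓ)).toMulEquiv).symm.toEquiv

end Reduction

/-! ### The real subfield as the fixed field of conjugation -/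

section RealSubfield

variable {K : Type*} [Field K] [NumberField K] {ℓ : ℕ} [hℓ : Fact ℓ.Prime] (ι : K ≃ₐ[ℚ] K)

/-- The fixed field of `ι`. -/
abbrev fixedSubfield : IntermediateField ℚ K :=
  IntermediateField.fixedField (Subgroup.zpowers ι)

variable {ι}

theorem mem_fixedSubfield_iff {x : K} : x ∈ fixedSubfield ι ↔ ι x = x := by
  rw [IntermediateField.mem_fixedField_iff]
  refine ⟨fun h => h ι (Subgroup.mem_zpowers ι), fun h σ hσ => ?_⟩
  have : Subgroup.zpowers ι ≤ MulAction.stabilizer (K ≃ₐ[ℚ] K) x := by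
    rw [Subgroup.zpowers_le]; exact h
  exact this hσ

/-- If `x = ℓ y` with `x` fixed by `ι`, then `y` is integral and also fixed, so `𝓞_E / ℓ` embeds in
`κ(ℓ)`. -/
theorem ker_reduction_fixedSubfield :
    RingHom.ker ((reduction K ℓ).comp (algebraMap (𝓞 (fixedSubfield ι)) (𝓞 K))) =
      Ideal.span {(ℓ : 𝓞 (fixedSubfield ι))} := by
  ext x
  rw [RingHom.mem_ker, RingHom.comp_apply, ← RingHom.mem_ker, ker_reduction,
    Ideal.mem_span_singleton, Ideal.mem_span_singleton]
  constructor
  · rintro ⟨y, hy⟩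
    have hy' : ((x : fixedSubfield ι) : K) = ℓ * (y : K) := by
      have := congrArg (algebraMap (𝓞 K) K) hy
      rwa [map_mul, map_natCast] at this
    have hℓ0 : (ℓ : K) ≠ 0 := by exact_mod_cast hℓ.out.ne_zero
    have hyE : (y : K) ∈ fixedSubfield ι := by
      rw [mem_fixedSubfield_iff]
      refine mul_left_cancel₀ hℓ0 ?_
      rw [← hy', ← mem_fixedSubfield_iff.1 (x : fixedSubfield ι).2, hy', map_mul, map_natCast]
    have hint : IsIntegral ℤ (⟨y, hyE⟩ : fixedSubfield ι) :=
      (isIntegral_algHom_iff ((fixedSubfield ι).val.restrictScalars ℤ)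
        Subtype.val_injective).1 y.isIntegral_coe
    obtain ⟨z, hz⟩ : ∃ z : 𝓞 (fixedSubfield ι), ((z : fixedSubfield ι) : K) = y :=
      ⟨⟨⟨y, hyE⟩, hint⟩, rfl⟩
    refine ⟨z, RingOfIntegers.ext (Subtype.ext ?_)⟩
    rw [hy', ← hz]
    simp
  · rintro ⟨y, rfl⟩
    exact ⟨algebraMap _ _ y, by simp⟩

/-- If `s` is fixed by `ι` and generates a subalgebra of `κ(ℓ)` of the same order as `𝓞_E / ℓ`,
where `E` is the fixed field of `ι`, then the unit groups have the same order. -/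
theorem natCard_units_adjoin {s : 𝓞 K} (hs : ι • s = s)
    (hcard : Nat.card (Algebra.adjoin (ZMod ℓ) {reduction K ℓ s}) =
      ℓ ^ Module.finrank ℚ (fixedSubfield ι)) :
    Nat.card (Algebra.adjoin (ZMod ℓ) {reduction K ℓ s})ˣ =
      Nat.card (𝓞 (fixedSubfield ι) ⧸ Ideal.span {(ℓ : 𝓞 (fixedSubfield ι))})ˣ := by
  set ψ := (reduction K ℓ).comp (algebraMap (𝓞 (fixedSubfield ι)) (𝓞 K)) with hψ
  have := finite_kappa K ℓ
  have hle : ((Algebra.adjoin (ZMod ℓ) {reduction K ℓ s} : Set (Kappa K ℓ))) ⊆ ψ.range := by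
    intro r hr
    induction hr using Algebra.adjoin_induction with
    | mem x hx =>
      have hsE : (s : K) ∈ fixedSubfield ι :=
        mem_fixedSubfield_iff.2 (congrArg (algebraMap (𝓞 K) K) hs)
      have hint : IsIntegral ℤ (⟨s, hsE⟩ : fixedSubfield ι) :=
        (isIntegral_algHom_iff ((fixedSubfield ι).val.restrictScalars ℤ)
          Subtype.val_injective).1 s.isIntegral_coe
      rw [Set.mem_singleton_iff.1 hx]
      exact ⟨⟨⟨s, hsE⟩, hint⟩, congrArg (reduction K ℓ) (RingOfIntegers.ext rfl)⟩
    | algebraMap c =>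
      obtain ⟨n, rfl⟩ := ZMod.intCast_surjective c
      rw [map_intCast]
      exact intCast_mem _ n
    | add x y _ _ hx hy => exact add_mem hx hy
    | mul x y _ _ hx hy => exact mul_mem hx hy
  -- The subalgebra lies in the image of `𝓞_E / ℓ` and has the same cardinality.
  have heq : ((Algebra.adjoin (ZMod ℓ) {reduction K ℓ s} : Set (Kappa K ℓ))) = ψ.range := by
    refine Set.eq_of_subset_of_ncard_le hle ?_ (Set.toFinite _)
    rw [← Nat.card_coe_set_eq, ← Nat.card_coe_set_eq]
    refine le_of_eq (Eq.trans ?_ hcard.symm)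
    rw [← natCard_quotient_span_natCast, ← ker_reduction_fixedSubfield]
    exact Nat.card_congr ψ.quotientKerEquivRange.toEquiv.symm
  have heq' : (Algebra.adjoin (ZMod ℓ) {reduction K ℓ s}).toSubring = ψ.range :=
    SetLike.coe_injective heq
  rw [← ker_reduction_fixedSubfield, ← hψ]
  exact Nat.card_congr (Units.mapEquiv
    (ψ.quotientKerEquivRange.trans (RingEquiv.subringCongr heq'.symm)).toMulEquiv).symm.toEquiv

theorem finrank_fixedSubfield [IsGalois ℚ K] (h4 : Module.finrank ℚ K = 4) (h2 : orderOf ι = 2) :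
    Module.finrank ℚ (fixedSubfield ι) = 2 := by
  have h := Module.finrank_mul_finrank ℚ (fixedSubfield ι) K
  rw [IntermediateField.finrank_fixedField_eq_card, Nat.card_zpowers, h2, h4] at h
  omega

theorem isGalois_fixedSubfield [IsGalois ℚ K] (hcomm : ∀ σ τ : K ≃ₐ[ℚ] K, σ * τ = τ * σ) :
    IsGalois ℚ (fixedSubfield ι) := by
  have : (Subgroup.zpowers ι).Normal := ⟨fun σ hσ τ => by
    rwa [hcomm τ σ, mul_inv_cancel_right]⟩
  exact IsGalois.of_fixedField_normal_subgroup _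

theorem mem_maximalRealSubfield_iff_of_isConj
    (hι : ∀ φ : K →+* ℂ, ComplexEmbedding.IsConj φ ι) {x : K} :
    x ∈ maximalRealSubfield K ↔ ι x = x := by
  rw [mem_maximalRealSubfield_iff]
  obtain ⟨φ⟩ : Nonempty (K →+* ℂ) := inferInstance
  refine ⟨fun h => φ.injective (by rw [(hι φ).eq, h]), fun h φ => by rw [← (hι φ).eq, h]⟩

theorem mem_imagChars_iff [IsGalois ℚ K] [IsGalois ℚ (fixedSubfield ι)]
    (hι : ∀ φ : K →+* ℂ, ComplexEmbedding.IsConj φ ι) (χ : (K ≃ₐ[ℚ] K) →* ℂˣ) :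
    χ ∈ imagChars K ↔ ¬ (resHom (fixedSubfield ι) K).ker ≤ χ.ker := by
  refine not_congr (forall_congr' fun σ => ?_)
  rw [mem_ker_resHom_iff, MonoidHom.mem_ker]
  refine imp_congr ⟨fun h x => h x ?_, fun h x hx => h ⟨x, ?_⟩⟩ Iff.rfl
  · exact (mem_maximalRealSubfield_iff_of_isConj hι).2 (mem_fixedSubfield_iff.1 x.2)
  · exact mem_fixedSubfield_iff.2 ((mem_maximalRealSubfield_iff_of_isConj hι).1 hx)

end RealSubfield

/-! ### The tower attached to a Weil quartic and the comparison of local factors -/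

namespace IsAdmissible

variable {p q : ℕ} {f : ℤ[X]} {K : Type*} [Field K] [NumberField K] {ϖ : K}
  {ℓ : ℕ} [hℓ : Fact ℓ.Prime]

/-- `κ(ℓ)` is a quadratic tower over the subalgebra generated by `ϖ + ϖ̄`. -/
theorem exists_quadTower_kappa (hf : IsAdmissible p q f K ϖ) (hq : (q : ZMod ℓ) ≠ 0)
    {ι : K ≃ₐ[ℚ] K} {w : 𝓞 K} (hw : (w : K) = ϖ) (htop : Algebra.adjoin ℤ {w, ι • w} = ⊤)
    (hmul : ϖ * ι ϖ = q)
    (hquad : (ϖ + ι ϖ) ^ 2 + f.coeff 3 * (ϖ + ι ϖ) + (f.coeff 2 - 2 * q) = 0) :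
    ∃ Q : QuadTower (ZMod ℓ) (Algebra.adjoin (ZMod ℓ) {reduction K ℓ (w + ι • w)}) (Kappa K ℓ),
      Q.T = reduction K ℓ w ∧ Q.Tbar = reduction K ℓ (ι • w) ∧ Q.q = q := by
  have hmul' : w * ι • w = q := RingOfIntegers.ext (by
    subst hw
    exact hmul.trans (map_natCast (algebraMap (𝓞 K) K) q).symm)
  have hquad' : (w + ι • w) * (w + ι • w) =
      -f.coeff 3 * (w + ι • w) + (2 * q - f.coeff 2) := RingOfIntegers.ext (by
    subst hw
    simp only [map_mul, map_add, map_sub, map_neg, map_intCast, map_natCast, map_ofNat]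
    change ((w : K) + ι w) * (w + ι w) = -f.coeff 3 * (w + ι w) + (2 * q - f.coeff 2)
    linear_combination hquad)
  set S := reduction K ℓ (w + ι • w) with hS
  set T := reduction K ℓ w with hT
  have hSS : S * S = algebraMap (ZMod ℓ) (Kappa K ℓ) (-f.coeff 3) * S +
      algebraMap (ZMod ℓ) (Kappa K ℓ) (2 * q - f.coeff 2) := by
    rw [hS, ← map_mul, hquad']
    simp only [map_mul, map_add, map_sub, map_neg, map_intCast, map_natCast, map_ofNat]
  have hTT : T * T = S * T - algebraMap (ZMod ℓ) (Kappa K ℓ) q := by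
    rw [map_natCast, ← map_natCast (reduction K ℓ), ← hmul', ← map_mul, ← map_mul, ← map_sub]
    congr 1
    ring
  have hgen : Algebra.adjoin (ZMod ℓ) {S, T} = ⊤ := by
    refine Algebra.eq_top_iff.2 fun z => ?_
    obtain ⟨a, rfl⟩ := reduction_surjective K ℓ z
    have hT' : T ∈ Algebra.adjoin (ZMod ℓ) {S, T} := Algebra.subset_adjoin (by simp)
    have hS' : S ∈ Algebra.adjoin (ZMod ℓ) {S, T} := Algebra.subset_adjoin (by simp)
    have ha : a ∈ Algebra.adjoin ℤ {w, ι • w} := htop ▸ Algebra.mem_top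
    induction ha using Algebra.adjoin_induction with
    | mem x hx =>
      rcases hx with rfl | rfl
      · exact hT'
      · rw [← add_sub_cancel_left w (ι • w), map_sub]
        exact sub_mem hS' hT'
    | algebraMap n => simp
    | add x y _ _ hx hy => rw [map_add]; exact add_mem hx hy
    | mul x y _ _ hx hy => rw [map_mul]; exact mul_mem hx hy
  obtain ⟨Q, hQs, hQT, hQq⟩ := exists_quadTower hq
    (by rw [Algebra.smul_def, Algebra.smul_def, mul_one]; exact hSS) hTT hgen
    (by rw [finrank_kappa, hf.finrank_eq])
  refine ⟨Q, hQT, ?_, hQq⟩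
  rw [QuadTower.Tbar, hQT]
  change (Q.s : Kappa K ℓ) - T = _
  rw [hQs, hS, hT, ← map_sub, add_sub_cancel_left]

end IsAdmissible

/-! ### Conjugation-symplectic forms and the value of `ν_ℓ(f)` -/

section Comparison

variable {K : Type*} [Field K] {ℓ : ℕ} [hℓ : Fact ℓ.Prime] {R : Type*} [CommRing R]
  [Algebra (ZMod ℓ) R] [Algebra R (Kappa K ℓ)] [IsScalarTower (ZMod ℓ) R (Kappa K ℓ)]
  (Q : QuadTower (ZMod ℓ) R (Kappa K ℓ)) {w : 𝓞 K}

/-- The forms of the tower attached to generators are conjugation-symplectic. -/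
theorem QuadTower.form_isConjSymplectic [NumberField K] {ι : K ≃ₐ[ℚ] K}
    (hι : ∀ φ : K →+* ℂ, ComplexEmbedding.IsConj φ ι)
    (hιι : ι • ι • w = w) (htop : Algebra.adjoin ℤ {w, ι • w} = ⊤) (hT : Q.T = reduction K ℓ w)
    (hTbar : Q.Tbar = reduction K ℓ (ι • w)) {μ : R →ₗ[ZMod ℓ] ZMod ℓ} (hμ : IsGenerator μ) :
    IsConjSymplectic K ℓ (Q.form μ) := by
  refine ⟨Q.form_isAlt μ, Q.form_nondegenerate hμ, ι, hι, fun a => ?_⟩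
  simp only [← reduction_apply]
  have ha : a ∈ Algebra.adjoin ℤ {w, ι • w} := htop ▸ Algebra.mem_top
  induction ha using Algebra.adjoin_induction with
  | mem x hx =>
    intro y z
    rcases hx with rfl | rfl
    · rw [← hT, ← hTbar, Q.form_T_mul_left]
    · rw [hιι, ← hT, ← hTbar, Q.form_Tbar_mul_left]
  | algebraMap n =>
    intro y z
    have h : ι • (n : 𝓞 K) = n := RingOfIntegers.ext (by
      change ι (algebraMap (𝓞 K) K n) = _
      simp)
    rw [eq_intCast, h, map_intCast, ← zsmul_eq_mul, ← zsmul_eq_mul, map_zsmul, map_zsmul]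
    rfl
  | add a b _ _ ha hb =>
    intro y z
    rw [smul_add, map_add, map_add, add_mul, add_mul, map_add, map_add, LinearMap.add_apply, ha, hb]
  | mul a b _ _ ha hb =>
    intro y z
    rw [smul_mul', map_mul (reduction K ℓ), map_mul (reduction K ℓ), mul_assoc, ha, hb,
      ← mul_assoc, mul_comm (reduction K ℓ _)]

/-- Every conjugation-symplectic form comes from a generator. -/
theorem QuadTower.exists_eq_form_of_isConjSymplectic [NumberField K] {ι : K ≃ₐ[ℚ] K}
    (hι : ∀ φ : K →+* ℂ, ComplexEmbedding.IsConj φ ι)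
    (hT : Q.T = reduction K ℓ w) (hTbar : Q.Tbar = reduction K ℓ (ι • w))
    {B : LinearMap.BilinForm (ZMod ℓ) (Kappa K ℓ)} (hB : IsConjSymplectic K ℓ B) :
    ∃ μ : R →ₗ[ZMod ℓ] ZMod ℓ, IsGenerator μ ∧ B = Q.form μ := by
  obtain ⟨halt, hnd, ι', hι', hadj⟩ := hB
  obtain ⟨φ⟩ : Nonempty (K →+* ℂ) := inferInstance
  obtain rfl : ι' = ι := (hι' φ).ext (hι φ)
  -- Adjointness for `w` makes `T` a similitude: `B(T a, T b) = B(a, Tbar T b) = q B(a, b)`.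
  obtain ⟨μ, rfl⟩ := Q.exists_eq_form halt fun a b => by
    have h := hadj w a (Q.T * b)
    rw [← reduction_apply, ← reduction_apply, ← hT, ← hTbar, ← mul_assoc, mul_comm Q.Tbar,
      Q.T_mul_Tbar, ← Algebra.smul_def, map_smul] at h
    exact h
  exact ⟨μ, Q.isGenerator_of_nondegenerate hnd, rfl⟩

theorem stdForm_equivFun {k V : Type*} [Field k] [AddCommGroup V] [Module k V]
    {B : LinearMap.BilinForm k V} {b : Module.Basis (Fin 2 ⊕ Fin 2) k V}
    (hb : ∀ i j, B (b i) (b j) = J k i j) (x y : V) :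
    stdForm k (b.equivFun x) (b.equivFun y) = B x y := by
  have h : (stdForm k).compl₁₂ b.equivFun.toLinearMap b.equivFun.toLinearMap = B :=
    LinearMap.BilinForm.ext_basis b fun i j => by
      simp [hb, stdForm, Matrix.toBilin'_single, Finsupp.single_eq_pi_single]
  rw [← h]
  rfl

/-- The matrix of the action of `ϖ` in a symplectic basis, and the value of `ν_ℓ(f)`. -/
theorem QuadTower.exists_isFrobMatrix {q : ℕ} (hq : Q.q = q) (hT : Q.T = reduction K ℓ w)
    {μ : R →ₗ[ZMod ℓ] ZMod ℓ} {b : Module.Basis (Fin 2 ⊕ Fin 2) (ZMod ℓ) (Kappa K ℓ)}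
    (hb : IsSymplecticBasis (Q.form μ) b) :
    ∃ γ ∈ GSpMult (ZMod ℓ) (q : ZMod ℓ), IsFrobMatrix (w : K) b γ ∧
      nuF ℓ q γ = (ℓ : ℚ) ^ 2 * Nat.card Rˣ / Nat.card (Kappa K ℓ)ˣ := by
  have := Q.finite_A
  let γ : GL (Fin 2 ⊕ Fin 2) (ZMod ℓ) :=
    Units.map (MonoidHomClass.toMonoidHom (LinearMap.toMatrixAlgEquiv b))
      (Units.map (MonoidHomClass.toMonoidHom (Algebra.lmul (ZMod ℓ) (Kappa K ℓ))) Q.isUnit_T.unit)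
  have hγ : γ.1 = LinearMap.toMatrix b b (LinearMap.mulLeft (ZMod ℓ) Q.T) := rfl
  have hact : ∀ a, γ.1.mulVec (b.equivFun a) = b.equivFun (Q.T * a) := fun a =>
    LinearMap.toMatrix_mulVec_repr b b (LinearMap.mulLeft (ZMod ℓ) Q.T) a
  have hmem : γ ∈ GSpMult (ZMod ℓ) Q.q := by
    rw [mem_GSpMult_iff]
    intro v v'
    obtain ⟨x, rfl⟩ := b.equivFun.surjective v
    obtain ⟨y, rfl⟩ := b.equivFun.surjective v'
    rw [hact, hact, stdForm_equivFun hb, stdForm_equivFun hb, Q.form_T_mul]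
  have hcount := Q.ncard_sameSemisimplification_mul b.equivFun hmem hact
  rw [hq] at hmem hcount
  refine ⟨γ, hmem, ⟨w, rfl, by rw [hγ, hT]; rfl⟩, ?_⟩
  have hG : ((GSpMult (ZMod ℓ) (q : ZMod ℓ)).ncard : ℚ) ≠ 0 := by
    exact_mod_cast (Set.ncard_pos (Set.toFinite _)).2 ⟨γ, hmem⟩ |>.ne'
  have hA : (Nat.card (Kappa K ℓ)ˣ : ℚ) ≠ 0 := by exact_mod_cast Nat.card_pos.ne'
  have hℓ0 : (ℓ : ℚ) ≠ 0 := by exact_mod_cast hℓ.out.ne_zero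
  have hcount' := congrArg (fun n : ℕ => (n : ℚ)) hcount
  push_cast at hcount'
  rw [nuF]
  field_simp
  linear_combination hcount'

end Comparison

end WeilSurface

end

open WeilSurface in
theorem mainTheorem3 (p q : ℕ) (hp : p.Prime) (f : Polynomial ℤ)
    (K : Type*) [Field K] [NumberField K] [IsGalois ℚ K] (ϖ : K)
    (hf : IsAdmissible p q f K ϖ) (ℓ : ℕ) [Fact ℓ.Prime] (hℓ : ℓ ≠ p) :
    -- the data entering the definition of `ν_ℓ(f)` exist
    (∃ B : LinearMap.BilinForm (ZMod ℓ) (Kappa K ℓ), IsConjSymplectic K ℓ B) ∧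
    -- and the identity holds for every choice of them
    ∀ B : LinearMap.BilinForm (ZMod ℓ) (Kappa K ℓ), IsConjSymplectic K ℓ B →
      (∃ b, IsSymplecticBasis B b) ∧
      ∀ b, IsSymplecticBasis B b →
        ∃ γ ∈ GSpMult (ZMod ℓ) (q : ZMod ℓ), IsFrobMatrix ϖ b γ ∧
          (nuF ℓ q γ : ℂ) = nuK K ℓ := by
  obtain ⟨ι, hι, hmul, hι1, hquad⟩ := hf.exists_conj hp
  obtain ⟨w, rfl, htop⟩ := hf.exists_adjoin_eq_top hι
  obtain ⟨Q, hT, hTbar, hq⟩ :=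
    hf.exists_quadTower_kappa (hf.natCast_ne_zero hp hℓ) rfl htop hmul hquad
  obtain ⟨φ⟩ : Nonempty (K →+* ℂ) := inferInstance
  have hord := ComplexEmbedding.orderOf_isConj_two_of_ne_one (hι φ) hι1
  have hιι : ι * ι = 1 := by rw [← sq, ← hord, pow_orderOf_eq_one]
  have hιw : ι • ι • w = w := by rw [← mul_smul, hιι, one_smul]
  refine ⟨⟨_, Q.form_isConjSymplectic hι hιw htop hT hTbar Q.isGenerator_coord⟩, fun B hB => ?_⟩
  obtain ⟨μ, hμ, rfl⟩ := Q.exists_eq_form_of_isConjSymplectic hι hT hTbar hB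
  refine ⟨Q.exists_symplectic_basis hμ, fun b hb => ?_⟩
  obtain ⟨γ, hγ, hfrob, hnu⟩ := Q.exists_isFrobMatrix hq hT hb
  refine ⟨γ, hγ, hfrob, ?_⟩
  have := isGalois_fixedSubfield (ι := ι) hf.gal_comm
  have hE := finrank_fixedSubfield hf.finrank_eq hord
  have hunits := natCard_units_adjoin (ℓ := ℓ) (ι := ι) (s := w + ι • w)
    (by rw [smul_add, hιw, add_comm]) (by
      have := Q.moduleFinite
      rw [Module.natCard_eq_pow_finrank (K := ZMod ℓ), Nat.card_zmod, hE,
        Module.finrank_eq_card_basis Q.basisR, Fintype.card_fin])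
  have hℓ0 : (ℓ : ℂ) ≠ 0 := by exact_mod_cast (Fact.out : ℓ.Prime).ne_zero
  -- Both sides become `ℓ² · #Rˣ / #Aˣ`, the field side as `(#Rˣ / ℓ²) / (#Aˣ / ℓ⁴)`.
  rw [hnu, nuK_eq hf.gal_comm (fixedSubfield ι) (mem_imagChars_iff hι), hE, hf.finrank_eq,
    ← hunits, ← natCard_units_kappa]
  push_cast
  field_simp
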